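/- Let $-1<q<1$ and $\mathcal H=\ell^2(\mathbb Z)$ with canonical basis $(e_i)_{i\in\mathbb Z}$. Let $\mathcal F_q$ be the $q$-deformed Fock space over $\mathcal H$, i.e. the completion of the linear span of the vacuum $\Omega$ and the elementary tensors $f_1\otimes\cdots\otimes f_n$ ($f_j\in\mathcal H$, $n\ge1$) for the inner product $$\langle f_1\otimes\cdots\otimes f_n,\,g_1\otimes\cdots\otimes g_m\rangle_q=\delta_{n,m}\sum_{\pi\in S_n}q^{i(\pi)}\langle f_1,g_{\pi(1)}\rangle\cdots\langle f_n,g_{\pi(n)}\rangle ,$$ where $i(\pi)$ is the number of inversions of $\pi$ and $\|\Omega\|=1$. Let $a_i^+$ be the bounded operator with $a_i^+\Omega=e_i$ and $a_i^+(f_1\otimes\cdots\otimes f_n)=e_i\otimes f_1\otimes\cdots\otimes f_n$, and let $a_i=(a_i^+)^*$. Let $\mathcal R_q$ and $\mathcal G_q$ be the unital $C^*$-algebras generated by $\{a_i : i\in\mathbb Z\}$ and by $\{a_i+a_i^+ : i\in\mathbb Z\}$, let $\alpha$ be the automorphism of $\mathcal R_q$ with $\alpha(a_i)=a_{i+1}$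 (it restricts to an automorphism of $\mathcal G_q$), and let $\omega=\langle\,\cdot\,\Omega,\Omega\rangle$ be the vacuum state. Call two $C^*$-dynamical systems $(\mathfrak A_j,\alpha_j,\omega_j)$, $j=1,2$ (a unital $C^*$-algebra, an automorphism, an invariant state), conjugate if there is a $*$-isomorphism $\beta:M_1\to M_2$ between $M_j=\pi_{\omega_j}(\mathfrak A_j)''$ ($\pi_{\omega_j}$ the GNS representation of $\omega_j$) with $\beta\hat\alpha_1=\hat\alpha_2\beta$ and $\hat\omega_2\circ\beta=\hat\omega_1$, where $\hat\alpha_j,\hat\omega_j$ are the canonical extensions of $\alpha_j,\omega_j$ to $M_j$. Then $(\mathcal R_q,\alpha,\omega)$ is not conjugate to $(\mathcal G_q,\alpha|_{\mathcal G_q},\omega|_{\mathcal G_q})$. Moreover, $\mathcal R_q''=\mathcal B(\mathcal F_q)$; $\mathcal G_q''$ is a $\mathrm{II}_1$ factor, and the vacuum state is a faithful normal tracial state on it; the von Neumann algebras $\mathcal R_q''$ and $\mathcal G_q''$ are not $*$-isomorphic, and neither are $\pi_\omega(\mathcal R_q)''$ and $\pi_{\omega|_{\mathcal G_q}}(\mathcal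 G_q)''$. -/

import Mathlib

open scoped ComplexOrder

noncomputable section

namespace QFock

/-- The one-particle Hilbert space `ℓ²(ℤ)`. -/
abbrev OneParticle : Type := lp (fun _ : ℤ => ℂ) 2

/-- The canonical basis vector `e i` of `ℓ²(ℤ)`. -/
def e (i : ℤ) : OneParticle := lp.single 2 i 1

/-- A word `(n, (f 0, …, f (n-1)))` stands for the elementary tensor `f 0 ⊗ ⋯ ⊗ f (n-1)`;
the word of length `0` stands for the vacuum. -/
abbrev Word : Type := Σ n : ℕ, Fin n → OneParticle

/-- The number of inversions of a permutation. -/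
def inversions {n : ℕ} (π : Equiv.Perm (Fin n)) : ℕ :=
  (Finset.univ.filter fun p : Fin n × Fin n => p.1 < p.2 ∧ π p.2 < π p.1).card

/-- The form `∑_π q ^ i(π) ⟨f 0, g (π 0)⟩ ⋯ ⟨f (n-1), g (π (n-1))⟩` on words of length `n`. -/
def levelForm (q : ℝ) {n : ℕ} (f g : Fin n → OneParticle) : ℂ :=
  ∑ π : Equiv.Perm (Fin n), (q : ℂ) ^ inversions π * ∏ k, inner ℂ (f k) (g (π k))

/-- The `q`-inner product of two elementary tensors; different particle numbers are orthogonal. -/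
def wordForm (q : ℝ) (w v : Word) : ℂ :=
  if h : v.1 = w.1 then levelForm q w.2 (fun k => v.2 (Fin.cast h.symm k)) else 0

theorem collapse {ι P : Type} [Fintype ι] [Fintype P] {G : Matrix (ι × P) (ι × P) ℂ}
    (hG : G.PosSemidef) :
    (Matrix.of fun i j => ∑ σ, ∑ τ, G (i, σ) (j, τ) : Matrix ι ι ℂ).PosSemidef := by
  refine .of_dotProduct_mulVec_nonneg ?_ fun x => ?_
  · ext i j
    simp only [Matrix.conjTranspose_apply, Matrix.of_apply, star_sum]
    rw [Finset.sum_comm]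
    refine Finset.sum_congr rfl fun σ _ => Finset.sum_congr rfl fun τ _ => ?_
    exact hG.isHermitian.apply _ _
  · have := hG.dotProduct_mulVec_nonneg (fun p : ι × P => x p.1)
    convert this using 1
    simp only [dotProduct, Matrix.mulVec, Fintype.sum_prod_type, Matrix.of_apply, Pi.star_apply,
      Finset.mul_sum, Finset.sum_mul]
    refine Finset.sum_congr rfl fun i _ => ?_
    rw [Finset.sum_comm]

theorem gram_prod {ι J : Type} [Finite ι] (s : Finset J) (u : ι → J → OneParticle) :
    (Matrix.of fun a b => ∏ j ∈ s, inner ℂ (u a j) (u b j) : Matrix ι ι ℂ).PosSemidef := by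
  classical
  induction s using Finset.induction_on with
  | empty =>
    have h : (Matrix.of fun a b => ∏ j ∈ (∅ : Finset J), inner ℂ (u a j) (u b j) : Matrix ι ι ℂ) =
        Matrix.gram ℂ (fun _ : ι => (1 : ℂ)) := by
      ext a b
      simp [Matrix.gram]
    rw [h]
    exact Matrix.posSemidef_gram ℂ _
  | insert j s hj ih =>
    have h : (Matrix.of fun a b => ∏ j ∈ insert j s, inner ℂ (u a j) (u b j) : Matrix ι ι ℂ) =
        Matrix.hadamard (Matrix.gram ℂ (fun a : ι => u a j))
          (Matrix.of fun a b => ∏ j ∈ s, inner ℂ (u a j) (u b j)) := by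
      ext a b
      simp [Finset.prod_insert hj, Matrix.gram, Matrix.hadamard]
    rw [h]
    exact (Matrix.posSemidef_gram ℂ (fun a : ι => u a j)).hadamard ih

/-- The sign that records the relative order of the values of `σ` at a pair of places. -/
def orderSign {n : ℕ} (σ : Equiv.Perm (Fin n)) (p : Fin n × Fin n) : ℝ :=
  if σ p.1 < σ p.2 then 1 else -1

theorem inversions_mul_inv {n : ℕ} (σ τ : Equiv.Perm (Fin n)) :
    inversions (τ * σ⁻¹) = (Finset.univ.filter fun p : Fin n × Fin n =>
      p.1 < p.2 ∧ ¬ (σ p.1 < σ p.2 ↔ τ p.1 < τ p.2)).card := by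
  have h1 : inversions (τ * σ⁻¹) = (Finset.univ.filter fun p : Fin n × Fin n =>
      σ p.1 < σ p.2 ∧ τ p.2 < τ p.1).card := by
    unfold inversions
    refine Finset.card_bij' (fun p _ => (σ⁻¹ p.1, σ⁻¹ p.2)) (fun p _ => (σ p.1, σ p.2)) ?_ ?_ ?_ ?_
    · intro p hp
      rw [Finset.mem_filter] at hp ⊢
      simpa using hp
    · intro p hp
      rw [Finset.mem_filter] at hp ⊢
      simpa using hp
    · simp
    · simp
  have h2 : (Finset.univ.filter fun p : Fin n × Fin n => σ p.1 < σ p.2 ∧ τ p.2 < τ p.1).card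
      = (Finset.univ.filter fun p : Fin n × Fin n =>
          p.1 < p.2 ∧ ¬ (σ p.1 < σ p.2 ↔ τ p.1 < τ p.2)).card := by
    refine Finset.card_bij' (fun p _ => if p.1 < p.2 then p else p.swap)
      (fun p _ => if σ p.1 < σ p.2 then p else p.swap) ?_ ?_ ?_ ?_
    · rintro ⟨a, b⟩ h
      simp only [Finset.mem_filter, Finset.mem_univ, true_and] at h ⊢
      have hab : a ≠ b := by rintro rfl; exact lt_irrefl _ h.1
      split_ifs with h'
      · exact ⟨h', fun hh => lt_asymm h.2 (hh.1 h.1)⟩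
      · refine ⟨lt_of_le_of_ne (not_lt.1 h') hab.symm, fun hh => ?_⟩
        exact lt_asymm h.1 (hh.2 h.2)
    · rintro ⟨a, b⟩ h
      simp only [Finset.mem_filter, Finset.mem_univ, true_and] at h ⊢
      have hab : a ≠ b := h.1.ne
      have hs : σ a ≠ σ b := fun hh => hab (σ.injective hh)
      have ht : τ a ≠ τ b := fun hh => hab (τ.injective hh)
      split_ifs with h'
      · refine ⟨h', lt_of_le_of_ne (not_lt.1 fun hh => h.2 ⟨fun _ => hh, fun _ => h'⟩) ht.symm⟩
      · refine ⟨lt_of_le_of_ne (not_lt.1 h') hs.symm, ?_⟩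
        by_contra hh
        exact h.2 ⟨fun h3 => absurd h3 h', fun h3 => absurd h3 hh⟩
    · rintro ⟨a, b⟩ h
      simp only [Finset.mem_filter, Finset.mem_univ, true_and] at h ⊢
      by_cases h' : a < b
      · simp [h', h.1]
      · simp [h', lt_asymm h.1]
    · rintro ⟨a, b⟩ h
      simp only [Finset.mem_filter, Finset.mem_univ, true_and] at h ⊢
      by_cases h' : σ a < σ b
      · simp [h', h.1]
      · simp [h', lt_asymm h.1]
  rw [h1, h2]

theorem q_pow_inversions (q : ℝ) {n : ℕ} (σ τ : Equiv.Perm (Fin n)) :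
    q ^ inversions (τ * σ⁻¹) =
      ∑ S ∈ (Finset.univ.filter fun p : Fin n × Fin n => p.1 < p.2).powerset,
        (((1 - q) / 2) ^ S.card *
          ((1 + q) / 2) ^ ((Finset.univ.filter fun p : Fin n × Fin n => p.1 < p.2) \ S).card) *
          ((∏ p ∈ S, orderSign σ p) * ∏ p ∈ S, orderSign τ p) := by
  set A := Finset.univ.filter fun p : Fin n × Fin n => p.1 < p.2 with hA
  have h1 : q ^ inversions (τ * σ⁻¹) =
      ∏ p ∈ A, ((1 - q) / 2 * (orderSign σ p * orderSign τ p) + (1 + q) / 2) := by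
    rw [inversions_mul_inv, ← Finset.filter_filter, ← hA, ← Finset.prod_const,
      Finset.prod_filter]
    refine Finset.prod_congr rfl fun p _ => ?_
    unfold orderSign
    by_cases ha : σ p.1 < σ p.2 <;> by_cases hb : τ p.1 < τ p.2 <;> simp [ha, hb] <;> ring
  rw [h1, Finset.prod_add]
  refine Finset.sum_congr rfl fun S _ => ?_
  rw [Finset.prod_mul_distrib, Finset.prod_mul_distrib, Finset.prod_const, Finset.prod_const]
  ring

theorem levelForm_symmetrized (q : ℝ) {n : ℕ} (f g : Fin n → OneParticle) :
    levelForm q f g = (Nat.factorial n : ℂ)⁻¹ *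
      ∑ σ : Equiv.Perm (Fin n), ∑ τ : Equiv.Perm (Fin n),
        (q : ℂ) ^ inversions (τ * σ⁻¹) * ∏ k, inner ℂ (f (σ k)) (g (τ k)) := by
  have h : ∀ σ : Equiv.Perm (Fin n), ∑ τ : Equiv.Perm (Fin n),
      (q : ℂ) ^ inversions (τ * σ⁻¹) * ∏ k, inner ℂ (f (σ k)) (g (τ k)) = levelForm q f g := by
    intro σ
    unfold levelForm
    refine Fintype.sum_equiv (Equiv.mulRight σ⁻¹) _ _ fun τ => ?_
    simp only [Equiv.coe_mulRight]
    congr 1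
    refine Fintype.prod_equiv σ _ _ fun k => ?_
    simp
  simp only [h, Finset.sum_const, Finset.card_univ, Fintype.card_perm, Fintype.card_fin,
    nsmul_eq_mul]
  rw [inv_mul_cancel_left₀]
  exact_mod_cast Nat.factorial_ne_zero n

theorem levelForm_expand (q : ℝ) {n : ℕ} (f g : Fin n → OneParticle) :
    levelForm q f g = (Nat.factorial n : ℂ)⁻¹ *
      ∑ S ∈ (Finset.univ.filter fun p : Fin n × Fin n => p.1 < p.2).powerset,
        ((((1 - q) / 2) ^ S.card *
          ((1 + q) / 2) ^ ((Finset.univ.filter fun p : Fin n × Fin n => p.1 < p.2) \ S).card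
            : ℝ) : ℂ) *
        ∑ σ : Equiv.Perm (Fin n), ∑ τ : Equiv.Perm (Fin n),
          (((∏ p ∈ S, orderSign σ p : ℝ) : ℂ) * ((∏ p ∈ S, orderSign τ p : ℝ) : ℂ)) *
            ∏ k, inner ℂ (f (σ k)) (g (τ k)) := by
  rw [levelForm_symmetrized]
  congr 1
  simp only [Finset.mul_sum]
  rw [Finset.sum_comm]
  conv_rhs => rw [Finset.sum_comm]
  rw [Finset.sum_comm]
  refine Finset.sum_congr rfl fun σ _ => ?_
  rw [Finset.sum_comm]
  refine Finset.sum_congr rfl fun τ _ => ?_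
  rw [← Complex.ofReal_pow, q_pow_inversions, Complex.ofReal_sum, Finset.sum_mul]
  refine Finset.sum_congr rfl fun S _ => ?_
  push_cast
  ring

theorem levelForm_posSemidef {q : ℝ} (hq : |q| < 1) {n : ℕ} {ι : Type} [Fintype ι]
    (u : ι → Fin n → OneParticle) :
    (Matrix.of fun a b => levelForm q (u a) (u b) : Matrix ι ι ℂ).PosSemidef := by
  obtain ⟨hq1, hq2⟩ := abs_lt.1 hq
  have hG : ∀ S : Finset (Fin n × Fin n), (Matrix.of fun a b : ι × Equiv.Perm (Fin n) =>
      (((∏ p ∈ S, orderSign a.2 p : ℝ) : ℂ) * ((∏ p ∈ S, orderSign b.2 p : ℝ) : ℂ)) *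
        ∏ k, inner ℂ (u a.1 (a.2 k)) (u b.1 (b.2 k))).PosSemidef := by
    intro S
    have h : (Matrix.of fun a b : ι × Equiv.Perm (Fin n) =>
      (((∏ p ∈ S, orderSign a.2 p : ℝ) : ℂ) * ((∏ p ∈ S, orderSign b.2 p : ℝ) : ℂ)) *
        ∏ k, inner ℂ (u a.1 (a.2 k)) (u b.1 (b.2 k))) = Matrix.hadamard
          (Matrix.gram ℂ fun p : ι × Equiv.Perm (Fin n) =>
            ((∏ x ∈ S, orderSign p.2 x : ℝ) : ℂ))
          (Matrix.of fun a b => ∏ j, inner ℂ (u a.1 (a.2 j)) (u b.1 (b.2 j))) := by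
      ext a b
      simp only [Matrix.of_apply, Matrix.hadamard_apply, Matrix.gram_apply, RCLike.inner_apply,
        Complex.conj_ofReal]
      ring
    have h1 := Matrix.posSemidef_gram ℂ fun p : ι × Equiv.Perm (Fin n) =>
      ((∏ x ∈ S, orderSign p.2 x : ℝ) : ℂ)
    have h2 := gram_prod Finset.univ fun (a : ι × Equiv.Perm (Fin n)) j => u a.1 (a.2 j)
    exact h ▸ h1.hadamard h2
  have hc : ∀ S : Finset (Fin n × Fin n), (0 : ℂ) ≤ ((((1 - q) / 2) ^ S.card *
      ((1 + q) / 2) ^ ((Finset.univ.filter fun p : Fin n × Fin n => p.1 < p.2) \ S).card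
        : ℝ) : ℂ) := fun S => by
    refine Complex.zero_le_real.2 (mul_nonneg (pow_nonneg (by linarith) _) (pow_nonneg (by linarith) _))
  have hn : (0 : ℂ) ≤ (Nat.factorial n : ℂ)⁻¹ := by
    rw [← Complex.ofReal_natCast, ← Complex.ofReal_inv]
    exact_mod_cast inv_nonneg.2 (Nat.cast_nonneg _)
  have key := (Matrix.posSemidef_sum (Finset.univ.filter fun p : Fin n × Fin n =>
    p.1 < p.2).powerset fun S _ => (collapse (hG S)).smul (hc S)).smul hn
  refine (congrArg Matrix.PosSemidef ?_).mpr key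
  ext a b
  simp only [Matrix.of_apply, Matrix.smul_apply, Matrix.sum_apply, levelForm_expand, smul_eq_mul]

theorem levelForm_conj {q : ℝ} (hq : |q| < 1) {n : ℕ} (f g : Fin n → OneParticle) :
    (starRingEnd ℂ) (levelForm q g f) = levelForm q f g := by
  have := (levelForm_posSemidef hq (fun b : Bool => if b then f else g)).isHermitian.apply
    true false
  simpa using this

theorem inversions_insert {n : ℕ} (k : Fin (n + 1)) (ρ : Equiv.Perm (Fin n))
    (π : Equiv.Perm (Fin (n + 1))) (h0 : π 0 = k) (hs : ∀ j : Fin n, π j.succ = k.succAbove (ρ j)) :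
    inversions π = k + inversions ρ := by
  have e1 : ∀ {m : ℕ} (π : Equiv.Perm (Fin m)), inversions π =
      ∑ i, ∑ j, if i < j ∧ π j < π i then 1 else 0 := by
    intro m π
    rw [← Fintype.sum_prod_type', inversions, Finset.card_filter]
  rw [e1, e1, Fin.sum_univ_succ]
  congr 1
  · rw [Fin.sum_univ_succ]
    simp only [h0, hs, Fin.succ_pos, true_and, lt_self_iff_false, false_and, if_false, zero_add]
    rw [Equiv.sum_comp ρ (fun j => if k.succAbove j < k then 1 else 0)]
    simp only [Fin.succAbove_lt_iff_castSucc_lt]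
    rw [← Finset.card_filter]
    have h := @Fin.card_filter_val_lt n k
    rw [min_eq_right (Nat.lt_succ_iff.1 k.2)] at h
    rw [← h]
    congr 1
  · refine Finset.sum_congr rfl fun i _ => ?_
    rw [Fin.sum_univ_succ]
    simp [h0, hs]

/-- The permutation that sends `0` to `k` and `j + 1` to the `ρ j`-th place different from `k`. -/
def insertPerm {n : ℕ} (p : Fin (n + 1) × Equiv.Perm (Fin n)) : Equiv.Perm (Fin (n + 1)) :=
  p.1.cycleRange.symm * Equiv.Perm.decomposeFin.symm (0, p.2)

theorem insertPerm_zero {n : ℕ} (k : Fin (n + 1)) (ρ : Equiv.Perm (Fin n)) :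
    insertPerm (k, ρ) 0 = k := by
  simp [insertPerm]

theorem insertPerm_succ {n : ℕ} (k : Fin (n + 1)) (ρ : Equiv.Perm (Fin n)) (j : Fin n) :
    insertPerm (k, ρ) j.succ = k.succAbove (ρ j) := by
  simp [insertPerm]

theorem insertPerm_bijective (n : ℕ) : Function.Bijective (@insertPerm n) := by
  rw [Fintype.bijective_iff_injective_and_card]
  constructor
  · rintro ⟨k, ρ⟩ ⟨l, σ⟩ h
    have h0 : k = l := by rw [← insertPerm_zero k ρ, h, insertPerm_zero]
    subst h0
    congr 1
    ext j
    have := congrArg (fun π => π j.succ) h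
    simp only [insertPerm_succ] at this
    rw [Fin.succAbove_right_injective this]
  · simp [Fintype.card_perm, Nat.factorial_succ]

/-- Expansion of the `q`-form along the first vector of the left argument. -/
theorem levelForm_cons (q : ℝ) {n : ℕ} (x : OneParticle) (f : Fin n → OneParticle)
    (g : Fin (n + 1) → OneParticle) :
    levelForm q (Fin.cons x f : Fin (n + 1) → OneParticle) g =
      ∑ k : Fin (n + 1), (q : ℂ) ^ (k : ℕ) * inner ℂ x (g k) * levelForm q f (k.removeNth g) := by
  conv_lhs => unfold levelForm
  rw [← (Equiv.ofBijective _ (insertPerm_bijective n)).sum_comp, Fintype.sum_prod_type]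
  refine Finset.sum_congr rfl fun k _ => ?_
  unfold levelForm
  rw [Finset.mul_sum]
  refine Finset.sum_congr rfl fun ρ _ => ?_
  simp only [Equiv.ofBijective_apply]
  rw [inversions_insert k ρ _ (insertPerm_zero k ρ) (insertPerm_succ k ρ), Fin.prod_univ_succ]
  simp only [Fin.cons_zero, Fin.cons_succ, insertPerm_zero, insertPerm_succ, Fin.removeNth]
  rw [pow_add]
  ring


/-- Finite formal linear combinations of elementary tensors, to be equipped with the
`q`-inner product. Combinations that are equal as tensors differ by a null vector of this form,
so they are identified in the completion. -/
def PreFock (q : ℝ) (_hq : |q| < 1) : Type := Word →₀ ℂ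

variable {q : ℝ} {hq : |q| < 1}

instance : AddCommGroup (PreFock q hq) := inferInstanceAs (AddCommGroup (Word →₀ ℂ))
instance : Module ℂ (PreFock q hq) := inferInstanceAs (Module ℂ (Word →₀ ℂ))

/-- The sesquilinear extension of `wordForm`, conjugate linear in the first variable. -/
def preInner (q : ℝ) (x y : Word →₀ ℂ) : ℂ :=
  x.sum fun w c => y.sum fun v d => (starRingEnd ℂ) c * wordForm q w v * d

theorem wordForm_conj (hq : |q| < 1) (w v : Word) :
    (starRingEnd ℂ) (wordForm q v w) = wordForm q w v := by
  obtain ⟨n, f⟩ := w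
  obtain ⟨m, g⟩ := v
  unfold wordForm
  by_cases h : m = n
  · subst h
    simp [levelForm_conj hq]
  · simp [h, Ne.symm h]

theorem wordForm_same {n : ℕ} (f g : Fin n → OneParticle) :
    wordForm q ⟨n, f⟩ ⟨n, g⟩ = levelForm q f g := by
  simp [wordForm]

theorem preInner_self_nonneg (hq : |q| < 1) (x : Word →₀ ℂ) : 0 ≤ (preInner q x x).re := by
  classical
  have h1 : preInner q x x = ∑ n ∈ x.support.image Sigma.fst,
      ∑ w ∈ x.support with w.1 = n, ∑ v ∈ x.support with v.1 = n,
        (starRingEnd ℂ) (x w) * wordForm q w v * x v := by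
    unfold preInner Finsupp.sum
    rw [← Finset.sum_fiberwise_of_maps_to (g := Sigma.fst) (t := x.support.image Sigma.fst)
      (fun w hw => Finset.mem_image_of_mem _ hw)]
    refine Finset.sum_congr rfl fun n _ => Finset.sum_congr rfl fun w hw => ?_
    rw [Finset.mem_filter] at hw
    rw [Finset.sum_filter]
    refine Finset.sum_congr rfl fun v _ => ?_
    split_ifs with h
    · rfl
    · have : ¬ v.1 = w.1 := fun h' => h (h'.trans hw.2)
      simp [wordForm, this]
  rw [h1, Complex.re_sum]
  refine Finset.sum_nonneg fun n _ => ?_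
  set s : Finset Word := {w ∈ x.support | w.1 = n} with hs
  have hmem : ∀ w : s, w.1.1 = n := fun w => by
    exact (Finset.mem_filter.1 w.2).2
  have h2 := (levelForm_posSemidef hq (fun (w : s) (k : Fin n) =>
    w.1.2 (Fin.cast (hmem w).symm k))).dotProduct_mulVec_nonneg (fun w : s => x w.1)
  have h3 : ∀ w v : s, wordForm q w.1 v.1 = levelForm q
      (fun k : Fin n => w.1.2 (Fin.cast (hmem w).symm k))
      (fun k : Fin n => v.1.2 (Fin.cast (hmem v).symm k)) := by
    rintro ⟨⟨a, f⟩, ha⟩ ⟨⟨b, g⟩, hb⟩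
    obtain rfl : a = n := hmem ⟨⟨a, f⟩, ha⟩
    obtain rfl : b = a := hmem ⟨⟨b, g⟩, hb⟩
    exact wordForm_same f g
  have h4 := (Complex.le_def.1 h2).1
  rw [Complex.zero_re] at h4
  refine h4.trans_eq (congrArg Complex.re (Eq.symm ?_))
  rw [← Finset.sum_coe_sort s]
  simp only [dotProduct, Matrix.mulVec, Matrix.of_apply, Pi.star_apply, Finset.mul_sum]
  refine Finset.sum_congr rfl fun w _ => ?_
  rw [← Finset.sum_coe_sort s]
  refine Finset.sum_congr rfl fun v _ => ?_
  rw [h3, mul_assoc]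
  rfl

theorem preInner_add_left (x y z : Word →₀ ℂ) :
    preInner q (x + y) z = preInner q x z + preInner q y z := by
  unfold preInner
  refine Finsupp.sum_add_index' (fun w => ?_) (fun w a b => ?_)
  · simp
  · rw [← Finsupp.sum_add]
    simp only [map_add, add_mul]

theorem preInner_smul_left (r : ℂ) (x y : Word →₀ ℂ) :
    preInner q (r • x) y = (starRingEnd ℂ) r * preInner q x y := by
  unfold preInner
  refine (Finsupp.sum_smul_index' fun w => ?_).trans ?_
  · simp
  · simp only [Finsupp.mul_sum, smul_eq_mul, map_mul, mul_assoc]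

/-- The `q`-inner product on finite formal combinations of elementary tensors. -/
@[reducible] def preFockCore (q : ℝ) (hq : |q| < 1) :
    PreInnerProductSpace.Core ℂ (PreFock q hq) where
  inner x y := preInner q x y
  conj_inner_symm x y := by
    simp only [preInner, Finsupp.sum, map_sum, map_mul, Complex.conj_conj, wordForm_conj hq]
    rw [Finset.sum_comm]
    refine Finset.sum_congr rfl fun w _ => Finset.sum_congr rfl fun v _ => ?_
    ring
  re_inner_nonneg x := preInner_self_nonneg hq x
  add_left x y z := preInner_add_left x y z
  smul_left x y r := preInner_smul_left r x y

instance : SeminormedAddCommGroup (PreFock q hq) :=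
  InnerProductSpace.Core.toSeminormedAddCommGroup (c := preFockCore q hq)

instance : InnerProductSpace ℂ (PreFock q hq) :=
  InnerProductSpace.ofCore (preFockCore q hq)

end QFock

/-- The `q`-deformed Fock space over `ℓ²(ℤ)`. -/
def QFock (q : ℝ) (hq : |q| < 1) : Type :=
  UniformSpace.Completion (QFock.PreFock q hq)

namespace QFock

variable {q : ℝ} {hq : |q| < 1}

instance : NormedAddCommGroup (QFock q hq) :=
  inferInstanceAs (NormedAddCommGroup (UniformSpace.Completion (PreFock q hq)))

instance : InnerProductSpace ℂ (QFock q hq) :=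
  inferInstanceAs (InnerProductSpace ℂ (UniformSpace.Completion (PreFock q hq)))

instance : CompleteSpace (QFock q hq) :=
  inferInstanceAs (CompleteSpace (UniformSpace.Completion (PreFock q hq)))

/-- The canonical map of the pre-Hilbert space to its completion. -/
def toFock (q : ℝ) (hq : |q| < 1) : PreFock q hq →ₗᵢ[ℂ] QFock q hq :=
  (UniformSpace.Completion.toComplₗᵢ : PreFock q hq →ₗᵢ[ℂ] UniformSpace.Completion (PreFock q hq))

theorem fock_induction {P : QFock q hq → Prop} (hP : IsClosed {ξ | P ξ})
    (h : ∀ ξ, P (toFock q hq ξ)) (ξ : QFock q hq) : P ξ :=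
  UniformSpace.Completion.induction_on (α := PreFock q hq) (p := P) ξ hP h

/-- The elementary tensor `f 0 ⊗ ⋯ ⊗ f (n-1)` given by a word, in the pre-Hilbert space. -/
def preTensor (q : ℝ) (hq : |q| < 1) (w : Word) : PreFock q hq :=
  (Finsupp.single w 1 : Word →₀ ℂ)

theorem inner_preTensor (w v : Word) :
    inner ℂ (preTensor q hq w) (preTensor q hq v) = wordForm q w v := by
  change preInner q (Finsupp.single w 1) (Finsupp.single v 1) = _
  simp [preInner]

/-- A linear map out of the pre-Hilbert space is given by its values on elementary tensors. -/
def preLift {E : Type} [AddCommGroup E] [Module ℂ E] (F : Word → E) : PreFock q hq →ₗ[ℂ] E :=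
  Finsupp.linearCombination ℂ F

theorem preLift_preTensor {E : Type} [AddCommGroup E] [Module ℂ E] (F : Word → E) (w : Word) :
    preLift F (preTensor q hq w) = F w := by
  refine (Finsupp.linearCombination_single ℂ 1 w).trans (one_smul ℂ _)

theorem pre_induction {P : PreFock q hq → Prop} (h0 : P 0)
    (hadd : ∀ x y, P x → P y → P (x + y))
    (hsmul : ∀ (c : ℂ) w, P (c • preTensor q hq w)) (x : PreFock q hq) : P x := by
  refine Finsupp.induction_linear (motive := P) x h0 hadd fun w c => ?_
  have := hsmul c w
  have h : c • preTensor q hq w = (Finsupp.single w c : Word →₀ ℂ) :=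
    (Finsupp.smul_single c w 1).trans (by simp)
  rwa [h] at this

/-- Creation on elementary tensors: `f 0 ⊗ ⋯ ⊗ f (n-1) ↦ x ⊗ f 0 ⊗ ⋯ ⊗ f (n-1)`. -/
def preCreation (x : OneParticle) : PreFock q hq →ₗ[ℂ] PreFock q hq :=
  preLift fun w => preTensor q hq ⟨w.1 + 1, Fin.cons x w.2⟩

/-- Annihilation of a single elementary tensor. -/
def annWord (q : ℝ) (hq : |q| < 1) (x : OneParticle) : Word → PreFock q hq
  | ⟨0, _⟩ => 0
  | ⟨n + 1, f⟩ => ∑ k : Fin (n + 1),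
      ((q : ℂ) ^ (k : ℕ) * inner ℂ x (f k)) • preTensor q hq ⟨n, k.removeNth f⟩

/-- Annihilation on elementary tensors:
`f 0 ⊗ ⋯ ⊗ f (n-1) ↦ ∑ k, q ^ k ⟨x, f k⟩ f 0 ⊗ ⋯ ⊗ f (k-1) ⊗ f (k+1) ⊗ ⋯ ⊗ f (n-1)`. -/
def preAnnihilation (x : OneParticle) : PreFock q hq →ₗ[ℂ] PreFock q hq :=
  preLift (annWord q hq x)

theorem inner_preCreation_preTensor (x : OneParticle) (w v : Word) :
    inner ℂ (preCreation x (preTensor q hq w)) (preTensor q hq v) =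
      inner ℂ (preTensor q hq w) (preAnnihilation x (preTensor q hq v)) := by
  rw [preCreation, preAnnihilation, preLift_preTensor, preLift_preTensor, inner_preTensor]
  obtain ⟨n, f⟩ := w
  obtain ⟨m, g⟩ := v
  cases m with
  | zero => simp [wordForm, annWord]
  | succ m =>
    simp only [annWord, inner_sum, inner_smul_right, inner_preTensor]
    by_cases h : m = n
    · subst h
      simp only [wordForm_same, levelForm_cons]
    · simp [wordForm, h]

theorem inner_preCreation (x : OneParticle) (ξ η : PreFock q hq) :
    inner ℂ (preCreation x ξ) η = inner ℂ ξ (preAnnihilation x η) := by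
  induction ξ using pre_induction with
  | h0 => simp
  | hadd a b ha hb => simp [inner_add_left, ha, hb]
  | hsmul c w =>
    induction η using pre_induction with
    | h0 => simp
    | hadd a b ha hb => simp only [inner_add_right, map_add, ha, hb]
    | hsmul d v =>
      simp only [map_smul, inner_smul_left, inner_smul_right, inner_preCreation_preTensor]

/-- The `q`-commutation relation on the pre-Hilbert space. -/
theorem pre_commutation (x y : OneParticle) (ξ : PreFock q hq) :
    preAnnihilation x (preCreation y ξ) =
      (inner ℂ x y : ℂ) • ξ + (q : ℂ) • preCreation y (preAnnihilation x ξ) := by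
  induction ξ using pre_induction with
  | h0 => simp
  | hadd a b ha hb => simp only [map_add, smul_add, ha, hb]; abel
  | hsmul c w =>
    simp only [map_smul]
    rw [smul_comm _ c, smul_comm _ c, ← smul_add]
    congr 1
    obtain ⟨n, f⟩ := w
    rw [preCreation, preAnnihilation, preLift_preTensor, preLift_preTensor, preLift_preTensor]
    simp only [annWord]
    rw [Fin.sum_univ_succ]
    simp only [Fin.val_zero, pow_zero, one_mul, Fin.cons_zero, Fin.removeNth_zero, Fin.tail_cons,
      Fin.val_succ, Fin.cons_succ]
    congr 1
    cases n with
    | zero => simp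
    | succ n =>
      simp only [map_sum, map_smul, preLift_preTensor, Finset.smul_sum]
      refine Finset.sum_congr rfl fun k _ => ?_
      rw [smul_smul, pow_succ]
      congr 1
      · ring
      · congr 2
        funext j
        refine Fin.cases ?_ (fun j => ?_) j <;> simp [Fin.removeNth]

/-- Combinations of elementary tensors with fewer than `n` factors. -/
def lowDegree (q : ℝ) (hq : |q| < 1) (n : ℕ) : Submodule ℂ (PreFock q hq) :=
  Submodule.span ℂ (preTensor q hq '' {w | w.1 < n})

theorem exists_lowDegree (ξ : PreFock q hq) : ∃ n, ξ ∈ lowDegree q hq n := by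
  have hmono : ∀ {m n}, m ≤ n → lowDegree q hq m ≤ lowDegree q hq n := fun h =>
    Submodule.span_mono (Set.image_mono fun w (hw : w.1 < _) => lt_of_lt_of_le hw h)
  induction ξ using pre_induction with
  | h0 => exact ⟨0, zero_mem _⟩
  | hadd a b ha hb =>
    obtain ⟨m, hm⟩ := ha
    obtain ⟨n, hn⟩ := hb
    exact ⟨max m n, add_mem (hmono (le_max_left _ _) hm) (hmono (le_max_right _ _) hn)⟩
  | hsmul c w =>
    exact ⟨w.1 + 1, Submodule.smul_mem _ _ (Submodule.subset_span ⟨w, Nat.lt_succ_self _, rfl⟩)⟩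

theorem preAnnihilation_lowDegree (x : OneParticle) (n : ℕ) {ξ : PreFock q hq}
    (h : ξ ∈ lowDegree q hq (n + 1)) : preAnnihilation x ξ ∈ lowDegree q hq n := by
  induction h using Submodule.span_induction with
  | mem y hy =>
    obtain ⟨⟨m, f⟩, hm, rfl⟩ := hy
    rw [preAnnihilation, preLift_preTensor]
    cases m with
    | zero => exact zero_mem _
    | succ m =>
      refine sum_mem fun k _ => Submodule.smul_mem _ _ (Submodule.subset_span ⟨_, ?_, rfl⟩)
      exact Nat.lt_of_succ_lt_succ hm
  | zero => simp
  | add a b _ _ ha hb => rw [map_add]; exact add_mem ha hb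
  | smul c a _ ha => rw [map_smul]; exact Submodule.smul_mem _ _ ha

theorem norm_preCreation_sq (x : OneParticle) (ξ : PreFock q hq) :
    ‖preCreation x ξ‖ ^ 2 = ‖x‖ ^ 2 * ‖ξ‖ ^ 2 + q * ‖preAnnihilation x ξ‖ ^ 2 := by
  have h : (inner ℂ (preCreation x ξ) (preCreation x ξ) : ℂ) =
      inner ℂ x x * inner ℂ ξ ξ + q * inner ℂ (preAnnihilation x ξ) (preAnnihilation x ξ) := by
    rw [inner_preCreation, pre_commutation, inner_add_right, inner_smul_right, inner_smul_right,
      ← inner_conj_symm ξ (preCreation x _), inner_preCreation, inner_conj_symm]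
  simp only [inner_self_eq_norm_sq_to_K] at h
  apply Complex.ofReal_injective
  push_cast
  exact h

theorem norm_preAnnihilation_sq_le (x : OneParticle) (ξ : PreFock q hq) :
    ‖preAnnihilation x ξ‖ ^ 2 ≤ ‖preCreation x (preAnnihilation x ξ)‖ * ‖ξ‖ := by
  have h : (inner ℂ (preAnnihilation x ξ) (preAnnihilation x ξ) : ℂ) =
      inner ℂ (preCreation x (preAnnihilation x ξ)) ξ := (inner_preCreation _ _ _).symm
  have h2 := norm_inner_le_norm (𝕜 := ℂ) (preCreation x (preAnnihilation x ξ)) ξ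
  rw [← h, inner_self_eq_norm_sq_to_K] at h2
  simpa using h2

theorem norm_preCreation_sq_le (x : OneParticle) (n : ℕ) :
    ∀ ξ ∈ lowDegree q hq n, ‖preCreation x ξ‖ ^ 2 ≤ ‖x‖ ^ 2 / (1 - |q|) * ‖ξ‖ ^ 2 := by
  have h1 : 0 < 1 - |q| := by linarith
  induction n with
  | zero =>
    intro ξ hξ
    have : ξ = 0 := by simpa [lowDegree] using hξ
    simp [this]
  | succ n ih =>
    intro ξ hξ
    set C := ‖x‖ ^ 2 / (1 - |q|) with hC
    have hC0 : 0 ≤ C := by positivity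
    have hCq : ‖x‖ ^ 2 + |q| * C = C := by
      rw [hC]; field_simp; ring
    have h2 := ih _ (preAnnihilation_lowDegree x n hξ)
    have h3 := norm_preAnnihilation_sq_le x ξ
    set a := ‖preAnnihilation x ξ‖
    set b := ‖preCreation x (preAnnihilation x ξ)‖
    have h4 : a ^ 2 ≤ C * ‖ξ‖ ^ 2 := by
      by_cases ha : a = 0
      · rw [ha, zero_pow two_ne_zero]
        exact mul_nonneg hC0 (sq_nonneg _)
      have ha' : 0 < a ^ 2 := pow_pos (lt_of_le_of_ne (norm_nonneg _) (Ne.symm ha)) 2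
      have h5 : (a ^ 2) ^ 2 ≤ (C * a ^ 2) * ‖ξ‖ ^ 2 := by
        calc (a ^ 2) ^ 2 ≤ (b * ‖ξ‖) ^ 2 := by gcongr
          _ = b ^ 2 * ‖ξ‖ ^ 2 := by ring
          _ ≤ _ := by gcongr
      nlinarith
    rw [norm_preCreation_sq]
    calc ‖x‖ ^ 2 * ‖ξ‖ ^ 2 + q * a ^ 2 ≤ ‖x‖ ^ 2 * ‖ξ‖ ^ 2 + |q| * (C * ‖ξ‖ ^ 2) := by
          gcongr
          exact le_abs_self q
      _ = (‖x‖ ^ 2 + |q| * C) * ‖ξ‖ ^ 2 := by ring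
      _ = C * ‖ξ‖ ^ 2 := by rw [hCq]

theorem norm_preCreation_le (x : OneParticle) (ξ : PreFock q hq) :
    ‖preCreation x ξ‖ ≤ Real.sqrt (‖x‖ ^ 2 / (1 - |q|)) * ‖ξ‖ := by
  obtain ⟨n, hn⟩ := exists_lowDegree ξ
  have h1 : 0 < 1 - |q| := by linarith
  rw [← abs_of_nonneg (norm_nonneg (preCreation x ξ))]
  refine Real.abs_le_sqrt (norm_preCreation_sq_le x n ξ hn) |>.trans (le_of_eq ?_)
  rw [Real.sqrt_mul (div_nonneg (sq_nonneg _) h1.le), Real.sqrt_sq (norm_nonneg _)]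

/-- The elementary tensor given by a word, in the `q`-Fock space. -/
def tensor (q : ℝ) (hq : |q| < 1) (w : Word) : QFock q hq := toFock q hq (preTensor q hq w)

/-- The vacuum vector. -/
def vacuum (q : ℝ) (hq : |q| < 1) : QFock q hq := tensor q hq ⟨0, Fin.elim0⟩

/-- The creator `a⁺(x)`, the bounded operator with
`a⁺(x) (f 0 ⊗ ⋯ ⊗ f (n-1)) = x ⊗ f 0 ⊗ ⋯ ⊗ f (n-1)`. -/
def creation (q : ℝ) (hq : |q| < 1) (x : OneParticle) : QFock q hq →L[ℂ] QFock q hq :=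
  (((preCreation x).mkContinuous _ (norm_preCreation_le x)).completion :
    UniformSpace.Completion (PreFock q hq) →L[ℂ] UniformSpace.Completion (PreFock q hq))

theorem creation_toFock (x : OneParticle) (ξ : PreFock q hq) :
    creation q hq x (toFock q hq ξ) = toFock q hq (preCreation x ξ) :=
  ContinuousLinearMap.completion_apply_coe ((preCreation x).mkContinuous _ (norm_preCreation_le x)) ξ

theorem creation_tensor (x : OneParticle) (w : Word) :
    creation q hq x (tensor q hq w) = tensor q hq ⟨w.1 + 1, Fin.cons x w.2⟩ := by
  rw [tensor, creation_toFock, preCreation, preLift_preTensor, tensor]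

/-- The creator `a_i⁺`. -/
def creator (q : ℝ) (hq : |q| < 1) (i : ℤ) : QFock q hq →L[ℂ] QFock q hq := creation q hq (e i)

/-- The annihilator `a_i`, the adjoint of `a_i⁺`. -/
def annihilator (q : ℝ) (hq : |q| < 1) (i : ℤ) : QFock q hq →L[ℂ] QFock q hq :=
  ContinuousLinearMap.adjoint (creator q hq i)

end QFock

/-- The extension of an isometric automorphism of a pre-Hilbert space to the completion. -/
def completionUnitary {V : Type*} [SeminormedAddCommGroup V] [InnerProductSpace ℂ V]
    (T : V ≃ₗᵢ[ℂ] V) : UniformSpace.Completion V ≃ₗᵢ[ℂ] UniformSpace.Completion V where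
  toFun := (T.toContinuousLinearEquiv : V →L[ℂ] V).completion
  invFun := (T.symm.toContinuousLinearEquiv : V →L[ℂ] V).completion
  map_add' := map_add _
  map_smul' := map_smul _
  left_inv x := by
    induction x using UniformSpace.Completion.induction_on with
    | hp => exact isClosed_eq (by fun_prop) continuous_id
    | ih x => simp
  right_inv x := by
    induction x using UniformSpace.Completion.induction_on with
    | hp => exact isClosed_eq (by fun_prop) continuous_id
    | ih x => simp
  norm_map' x := by
    change ‖(T.toContinuousLinearEquiv : V →L[ℂ] V).completion x‖ = ‖x‖
    induction x using UniformSpace.Completion.induction_on with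
    | hp => exact isClosed_eq (by fun_prop) continuous_norm
    | ih x => simp

theorem completionUnitary_coe {V : Type*} [SeminormedAddCommGroup V] [InnerProductSpace ℂ V]
    (T : V ≃ₗᵢ[ℂ] V) (x : V) :
    completionUnitary T (x : UniformSpace.Completion V) = (T x : V) := by
  change (T.toContinuousLinearEquiv : V →L[ℂ] V).completion x = _
  simp

namespace QFock

variable {q : ℝ} {hq : |q| < 1}

/-- Translation of `ℓ²(ℤ)` by `m`, `(translate m f) i = f (i - m)`. -/
def translate (m : ℤ) (f : OneParticle) : OneParticle :=
  ⟨fun i => f (i - m), by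
    have h := lp.memℓp f
    rw [memℓp_gen_iff (by norm_num)] at h
    exact (memℓp_gen_iff (by norm_num)).2 <| ((Equiv.subRight m).summable_iff (f := fun i => ‖f i‖ ^ (2 : ENNReal).toReal)).2 h⟩

theorem translate_apply (m : ℤ) (f : OneParticle) (i : ℤ) : translate m f i = f (i - m) := rfl

/-- The right shift of `ℓ²(ℤ)`, which maps `e i` to `e (i + 1)`. -/
def shift : OneParticle ≃ₗᵢ[ℂ] OneParticle where
  toFun := translate 1
  invFun := translate (-1)
  map_add' f g := by ext i; rfl
  map_smul' c f := by ext i; rfl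
  left_inv f := by ext i; simp [translate_apply]
  right_inv f := by ext i; simp [translate_apply]
  norm_map' f := by
    change ‖translate 1 f‖ = ‖f‖
    rw [lp.norm_eq_tsum_rpow (by norm_num), lp.norm_eq_tsum_rpow (by norm_num)]
    congr 1
    exact (Equiv.subRight (1 : ℤ)).tsum_eq (fun i => ‖f i‖ ^ (2 : ENNReal).toReal)

theorem shift_e (i : ℤ) : shift (e i) = e (i + 1) := by
  ext j
  change e i (j - 1) = e (i + 1) j
  simp only [e, lp.single_apply, Pi.single_apply, sub_eq_iff_eq_add]

/-- The action of a unitary of `ℓ²(ℤ)` on words. -/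
def mapWord (T : OneParticle ≃ₗᵢ[ℂ] OneParticle) (w : Word) : Word := ⟨w.1, fun k => T (w.2 k)⟩

theorem wordForm_mapWord (T : OneParticle ≃ₗᵢ[ℂ] OneParticle) (w v : Word) :
    wordForm q (mapWord T w) (mapWord T v) = wordForm q w v := by
  simp only [wordForm, mapWord, levelForm, LinearIsometryEquiv.inner_map_map]
  rfl

/-- The linear map on the pre-Hilbert space induced by a unitary of `ℓ²(ℤ)`. -/
def preMap (T : OneParticle ≃ₗᵢ[ℂ] OneParticle) : PreFock q hq →ₗ[ℂ] PreFock q hq :=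
  preLift fun w => preTensor q hq (mapWord T w)

theorem preMap_preMap (S T : OneParticle ≃ₗᵢ[ℂ] OneParticle) (h : ∀ x, S (T x) = x)
    (ξ : PreFock q hq) : preMap S (preMap T ξ) = ξ := by
  induction ξ using pre_induction with
  | h0 => simp
  | hadd a b ha hb => simp only [map_add, ha, hb]
  | hsmul c w =>
    simp only [map_smul, preMap, preLift_preTensor]
    simp [mapWord, h]

theorem inner_preMap (T : OneParticle ≃ₗᵢ[ℂ] OneParticle) (ξ η : PreFock q hq) :
    (inner ℂ (preMap T ξ) (preMap T η) : ℂ) = inner ℂ ξ η := by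
  induction ξ using pre_induction with
  | h0 => simp
  | hadd a b ha hb => simp only [inner_add_left, map_add, ha, hb]
  | hsmul c w =>
    induction η using pre_induction with
    | h0 => simp
    | hadd a b ha hb => simp only [inner_add_right, map_add, ha, hb]
    | hsmul d v =>
      simp only [map_smul, inner_smul_left, inner_smul_right, preMap, preLift_preTensor,
        inner_preTensor, wordForm_mapWord]

/-- The unitary of the pre-Hilbert space induced by a unitary of `ℓ²(ℤ)`. -/
def preUnitary (T : OneParticle ≃ₗᵢ[ℂ] OneParticle) : PreFock q hq ≃ₗᵢ[ℂ] PreFock q hq where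
  toLinearEquiv := LinearEquiv.ofLinearMap (preMap T) (preMap T.symm)
    (LinearMap.ext (preMap_preMap T T.symm T.apply_symm_apply))
    (LinearMap.ext (preMap_preMap T.symm T T.symm_apply_apply))
  norm_map' ξ := by
    change ‖preMap T ξ‖ = ‖ξ‖
    rw [norm_eq_sqrt_re_inner (𝕜 := ℂ), norm_eq_sqrt_re_inner (𝕜 := ℂ), inner_preMap]

/-- The second quantization of a unitary `T` of `ℓ²(ℤ)`, the unitary of the `q`-Fock space with
`f 0 ⊗ ⋯ ⊗ f (n-1) ↦ T (f 0) ⊗ ⋯ ⊗ T (f (n-1))`. -/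
def secondQuantization (q : ℝ) (hq : |q| < 1) (T : OneParticle ≃ₗᵢ[ℂ] OneParticle) :
    QFock q hq ≃ₗᵢ[ℂ] QFock q hq :=
  (completionUnitary (preUnitary T) :
    UniformSpace.Completion (PreFock q hq) ≃ₗᵢ[ℂ] UniformSpace.Completion (PreFock q hq))

theorem secondQuantization_tensor (T : OneParticle ≃ₗᵢ[ℂ] OneParticle) (w : Word) :
    secondQuantization q hq T (tensor q hq w) = tensor q hq (mapWord T w) := by
  refine (completionUnitary_coe (preUnitary T) (preTensor q hq w)).trans ?_
  exact congrArg (toFock q hq) (preLift_preTensor _ w)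

/-- A continuous linear map on the `q`-Fock space is determined by elementary tensors. -/
theorem ext_tensor {A B : QFock q hq →L[ℂ] QFock q hq}
    (h : ∀ w, A (tensor q hq w) = B (tensor q hq w)) : A = B := by
  ext ξ
  induction ξ using fock_induction with
  | hP => exact isClosed_eq A.continuous B.continuous
  | h ξ =>
    induction ξ using pre_induction with
    | h0 => simp
    | hadd a b ha hb => rw [map_add, map_add, map_add, ha, hb]
    | hsmul c w =>
      rw [map_smul, map_smul, map_smul]
      exact congrArg (c • ·) (h w)

/-- The automorphism of `B(F_q)` implemented by the second quantized right shift. -/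
def shiftAut (q : ℝ) (hq : |q| < 1) :
    (QFock q hq →L[ℂ] QFock q hq) ≃⋆ₐ[ℂ] (QFock q hq →L[ℂ] QFock q hq) :=
  (secondQuantization q hq shift).conjStarAlgEquiv

theorem shiftAut_creator (i : ℤ) : shiftAut q hq (creator q hq i) = creator q hq (i + 1) := by
  have h : ∀ ξ, secondQuantization q hq shift (creator q hq i ξ) =
      creator q hq (i + 1) (secondQuantization q hq shift ξ) := by
    have := ext_tensor (q := q) (hq := hq)
      (A := ((secondQuantization q hq shift).toContinuousLinearEquiv :
        QFock q hq →L[ℂ] QFock q hq) ∘L creator q hq i)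
      (B := creator q hq (i + 1) ∘L ((secondQuantization q hq shift).toContinuousLinearEquiv :
        QFock q hq →L[ℂ] QFock q hq)) (fun w => by
          simp only [creator, ContinuousLinearMap.comp_apply, ContinuousLinearEquiv.coe_coe,
            LinearIsometryEquiv.coe_toContinuousLinearEquiv, creation_tensor,
            secondQuantization_tensor]
          congr 1
          refine Sigma.ext rfl (heq_of_eq ?_)
          funext k
          refine Fin.cases ?_ (fun k => ?_) k <;> simp [mapWord, shift_e])
    exact fun ξ => congrArg (fun A => A ξ) this
  ext ξ
  rw [shiftAut, LinearIsometryEquiv.conjStarAlgEquiv_apply_apply, h,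
    LinearIsometryEquiv.apply_symm_apply]

theorem shiftAut_annihilator (i : ℤ) :
    shiftAut q hq (annihilator q hq i) = annihilator q hq (i + 1) := by
  exact ((shiftAut q hq).map_star' (creator q hq i)).trans
    (congrArg star (shiftAut_creator (q := q) (hq := hq) i))

end QFock

/-- The (unital) C⋆-algebra generated by a set of bounded operators. -/
def generatedCStarAlgebra {H : Type*} [NormedAddCommGroup H] [InnerProductSpace ℂ H]
    [CompleteSpace H] (s : Set (H →L[ℂ] H)) : StarSubalgebra ℂ (H →L[ℂ] H) :=
  (StarAlgebra.adjoin ℂ s).topologicalClosure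

instance {H : Type*} [NormedAddCommGroup H] [InnerProductSpace ℂ H]
    [CompleteSpace H] (s : Set (H →L[ℂ] H)) :
    IsClosed (generatedCStarAlgebra s : Set (H →L[ℂ] H)) :=
  StarSubalgebra.isClosed_topologicalClosure _

theorem unitary_conj_mem_generated {H : Type*} [NormedAddCommGroup H] [InnerProductSpace ℂ H]
    [CompleteSpace H] {s : Set (H →L[ℂ] H)} (U : H ≃ₗᵢ[ℂ] H)
    (hs : ∀ x ∈ s, U.conjStarAlgEquiv x ∈ s) {x : H →L[ℂ] H} (hx : x ∈ generatedCStarAlgebra s) :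
    U.conjStarAlgEquiv x ∈ generatedCStarAlgebra s := by
  have hc : Continuous U.conjStarAlgEquiv := by
    have : ⇑U.conjStarAlgEquiv = fun x => (U.toContinuousLinearEquiv : H →L[ℂ] H) ∘L x ∘L
        (U.symm.toContinuousLinearEquiv : H →L[ℂ] H) := by
      ext x; rfl
    rw [this]
    fun_prop
  have h1 : StarAlgebra.adjoin ℂ s ≤
      (StarAlgebra.adjoin ℂ s).comap U.conjStarAlgEquiv.toStarAlgHom :=
    StarAlgebra.adjoin_le fun x hx => StarAlgebra.subset_adjoin ℂ s (hs x hx)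
  exact map_mem_closure hc hx fun x hx => h1 hx

/-- Conjugation by a unitary which permutes the generators restricts to an automorphism of the
generated C⋆-algebra. -/
def restrictConj {H : Type*} [NormedAddCommGroup H] [InnerProductSpace ℂ H]
    [CompleteSpace H] (s : Set (H →L[ℂ] H)) (U : H ≃ₗᵢ[ℂ] H)
    (h1 : ∀ x ∈ s, U.conjStarAlgEquiv x ∈ s) (h2 : ∀ x ∈ s, U.symm.conjStarAlgEquiv x ∈ s) :
    generatedCStarAlgebra s ≃⋆ₐ[ℂ] generatedCStarAlgebra s where
  toFun x := ⟨U.conjStarAlgEquiv x, unitary_conj_mem_generated U h1 x.2⟩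
  invFun x := ⟨U.symm.conjStarAlgEquiv x, unitary_conj_mem_generated U.symm h2 x.2⟩
  left_inv x := Subtype.ext (U.conjStarAlgEquiv.symm_apply_apply x)
  right_inv x := Subtype.ext (U.conjStarAlgEquiv.apply_symm_apply x)
  map_mul' x y := Subtype.ext (map_mul U.conjStarAlgEquiv (x : H →L[ℂ] H) y)
  map_add' x y := Subtype.ext (map_add U.conjStarAlgEquiv (x : H →L[ℂ] H) y)
  map_star' x := Subtype.ext (map_star U.conjStarAlgEquiv (x : H →L[ℂ] H))
  map_smul' c x := Subtype.ext (map_smul U.conjStarAlgEquiv c (x : H →L[ℂ] H))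

/-- The double commutant of a ⋆-algebra of bounded operators, as a von Neumann algebra. -/
def doubleCommutant {H : Type*} [NormedAddCommGroup H] [InnerProductSpace ℂ H] [CompleteSpace H]
    (S : StarSubalgebra ℂ (H →L[ℂ] H)) : VonNeumannAlgebra H where
  toStarSubalgebra := StarSubalgebra.centralizer ℂ
    (StarSubalgebra.centralizer ℂ (S : Set (H →L[ℂ] H)) : Set (H →L[ℂ] H))
  centralizer_centralizer' := by simp

theorem star_centralizer {H : Type*} [NormedAddCommGroup H] [InnerProductSpace ℂ H]
    [CompleteSpace H] (S : StarSubalgebra ℂ (H →L[ℂ] H)) :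
    (StarSubalgebra.centralizer ℂ (S : Set (H →L[ℂ] H)) : Set (H →L[ℂ] H)) =
      Set.centralizer (S : Set (H →L[ℂ] H)) := by
  rw [StarSubalgebra.coe_centralizer, Set.union_eq_self_of_subset_right]
  exact fun x hx => by simpa using star_mem (Set.mem_star.1 hx)

theorem coe_doubleCommutant {H : Type*} [NormedAddCommGroup H] [InnerProductSpace ℂ H]
    [CompleteSpace H] (S : StarSubalgebra ℂ (H →L[ℂ] H)) :
    (doubleCommutant S : Set (H →L[ℂ] H)) =
      Set.centralizer (Set.centralizer (S : Set (H →L[ℂ] H))) := by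
  change ((StarSubalgebra.centralizer ℂ
    (StarSubalgebra.centralizer ℂ (S : Set (H →L[ℂ] H)) : Set (H →L[ℂ] H)) :
      StarSubalgebra ℂ (H →L[ℂ] H)) : Set (H →L[ℂ] H)) = _
  rw [star_centralizer, star_centralizer]

theorem unitary_conj_mem_doubleCommutant {H : Type*} [NormedAddCommGroup H]
    [InnerProductSpace ℂ H] [CompleteSpace H] {S : StarSubalgebra ℂ (H →L[ℂ] H)}
    (U : H ≃ₗᵢ[ℂ] H) (hU : ∀ x ∈ S, U.conjStarAlgEquiv x ∈ S) {x : H →L[ℂ] H}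
    (hx : x ∈ doubleCommutant S) : U.conjStarAlgEquiv x ∈ doubleCommutant S := by
  rw [← SetLike.mem_coe, coe_doubleCommutant] at hx ⊢
  intro y hy
  have h1 : U.conjStarAlgEquiv.symm y ∈ Set.centralizer (S : Set (H →L[ℂ] H)) := by
    intro s hs
    apply U.conjStarAlgEquiv.injective
    change U.conjStarAlgEquiv (s * _) = U.conjStarAlgEquiv (_ * s)
    rw [map_mul, map_mul, StarAlgEquiv.apply_symm_apply]
    exact hy _ (hU s hs)
  have h2 := congrArg U.conjStarAlgEquiv (hx _ h1)
  rwa [map_mul, map_mul, StarAlgEquiv.apply_symm_apply] at h2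

/-- Conjugation by a unitary which preserves a ⋆-algebra restricts to an automorphism of its
double commutant. -/
def doubleCommutantConj {H : Type*} [NormedAddCommGroup H] [InnerProductSpace ℂ H]
    [CompleteSpace H] (S : StarSubalgebra ℂ (H →L[ℂ] H)) (U : H ≃ₗᵢ[ℂ] H)
    (h1 : ∀ x ∈ S, U.conjStarAlgEquiv x ∈ S) (h2 : ∀ x ∈ S, U.symm.conjStarAlgEquiv x ∈ S) :
    (doubleCommutant S).toStarSubalgebra ≃⋆ₐ[ℂ] (doubleCommutant S).toStarSubalgebra where
  toFun x := ⟨U.conjStarAlgEquiv x, unitary_conj_mem_doubleCommutant U h1 x.2⟩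
  invFun x := ⟨U.symm.conjStarAlgEquiv x, unitary_conj_mem_doubleCommutant U.symm h2 x.2⟩
  left_inv x := Subtype.ext (U.conjStarAlgEquiv.symm_apply_apply x)
  right_inv x := Subtype.ext (U.conjStarAlgEquiv.apply_symm_apply x)
  map_mul' x y := Subtype.ext (map_mul U.conjStarAlgEquiv (x : H →L[ℂ] H) y)
  map_add' x y := Subtype.ext (map_add U.conjStarAlgEquiv (x : H →L[ℂ] H) y)
  map_star' x := Subtype.ext (U.conjStarAlgEquiv.map_star' (x : H →L[ℂ] H))
  map_smul' c x := Subtype.ext (map_smul U.conjStarAlgEquiv c (x : H →L[ℂ] H))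

/-- The functional `x ↦ ⟨x ξ, ξ⟩` on a ⋆-algebra of bounded operators. -/
def vectorFunctional {H : Type*} [NormedAddCommGroup H] [InnerProductSpace ℂ H] [CompleteSpace H]
    (S : StarSubalgebra ℂ (H →L[ℂ] H)) (ξ : H) : S →ₗ[ℂ] ℂ where
  toFun x := inner ℂ ξ ((x : H →L[ℂ] H) ξ)
  map_add' x y := by simp
  map_smul' c x := by simp

/-- A C⋆-dynamical system: a unital C⋆-algebra with an automorphism and an invariant state. -/
structure CStarDynamicalSystem where
  /-- the algebra -/
  A : Type*
  [cstarAlgebra : CStarAlgebra A]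
  /-- the dynamics -/
  α : A ≃⋆ₐ[ℂ] A
  /-- the state -/
  ω : A →ₗ[ℂ] ℂ
  ω_nonneg : ∀ a, 0 ≤ ω (star a * a)
  ω_one : ω 1 = 1
  ω_invariant : ∀ a, ω (α a) = ω a

namespace CStarDynamicalSystem

instance (S : CStarDynamicalSystem) : CStarAlgebra S.A := S.cstarAlgebra

instance (S : CStarDynamicalSystem) : PartialOrder S.A := CStarAlgebra.spectralOrder S.A

instance (S : CStarDynamicalSystem) : StarOrderedRing S.A := CStarAlgebra.spectralOrderedRing S.A

/-- The state as a positive linear functional. -/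
def state (S : CStarDynamicalSystem) : S.A →ₚ[ℂ] ℂ :=
  PositiveLinearMap.mk₀ S.ω fun x hx => by
    obtain ⟨b, rfl⟩ := CStarAlgebra.nonneg_iff_eq_star_mul_self.1 hx
    exact S.ω_nonneg b

theorem state_apply (S : CStarDynamicalSystem) (a : S.A) : S.state a = S.ω a := rfl

/-- The Hilbert space of the GNS representation of the state. -/
abbrev Hilbert (S : CStarDynamicalSystem) : Type _ := S.state.GNS

/-- The cyclic vector of the GNS representation. -/
def cyclicVector (S : CStarDynamicalSystem) : S.Hilbert :=
  (S.state.toPreGNS 1 : S.state.PreGNS)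

/-- The image of the GNS representation. -/
def gnsImage (S : CStarDynamicalSystem) : StarSubalgebra ℂ (S.Hilbert →L[ℂ] S.Hilbert) :=
  S.state.gnsStarAlgHom.range

/-- The von Neumann algebra `π_ω(A)''`. -/
def vonNeumann (S : CStarDynamicalSystem) : VonNeumannAlgebra S.Hilbert :=
  doubleCommutant S.gnsImage

/-- The unitary `π_ω(a) ξ_ω ↦ π_ω(α a) ξ_ω` on the GNS space. -/
def gnsUnitary (S : CStarDynamicalSystem) : S.Hilbert ≃ₗᵢ[ℂ] S.Hilbert :=
  completionUnitary
    { toLinearEquiv := S.state.ofPreGNS.trans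
        ((S.α.toAlgEquiv.toLinearEquiv).trans S.state.toPreGNS)
      norm_map' := fun a => by
        rw [PositiveLinearMap.preGNS_norm_def, PositiveLinearMap.preGNS_norm_def]
        congr 2
        change S.ω (star (S.α (S.state.ofPreGNS a)) * S.α (S.state.ofPreGNS a)) = _
        rw [← map_star, ← map_mul, S.ω_invariant]
        rfl }

theorem gnsUnitary_coe (S : CStarDynamicalSystem) (a : S.A) :
    S.gnsUnitary (S.state.toPreGNS a : S.state.PreGNS) =
      (S.state.toPreGNS (S.α a) : S.state.PreGNS) :=
  completionUnitary_coe _ _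

theorem gnsUnitary_conj (S : CStarDynamicalSystem) (a : S.A) :
    S.gnsUnitary.conjStarAlgEquiv (S.state.gnsStarAlgHom a) = S.state.gnsStarAlgHom (S.α a) := by
  have h : ∀ ξ, S.gnsUnitary (S.state.gnsStarAlgHom a ξ) =
      S.state.gnsStarAlgHom (S.α a) (S.gnsUnitary ξ) := by
    intro ξ
    induction ξ using UniformSpace.Completion.induction_on with
    | hp => exact isClosed_eq (by fun_prop) (by fun_prop)
    | ih b =>
      obtain ⟨b, rfl⟩ := S.state.toPreGNS.surjective b
      rw [gnsUnitary_coe]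
      simp [gnsUnitary_coe]
  ext ξ
  rw [LinearIsometryEquiv.conjStarAlgEquiv_apply_apply, h, LinearIsometryEquiv.apply_symm_apply]

theorem gnsUnitary_conj_mem (S : CStarDynamicalSystem) :
    ∀ x ∈ S.gnsImage, S.gnsUnitary.conjStarAlgEquiv x ∈ S.gnsImage := by
  rintro _ ⟨a, rfl⟩
  exact ⟨S.α a, (S.gnsUnitary_conj a).symm⟩

theorem gnsUnitary_symm_conj_mem (S : CStarDynamicalSystem) :
    ∀ x ∈ S.gnsImage, S.gnsUnitary.symm.conjStarAlgEquiv x ∈ S.gnsImage := by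
  rintro _ ⟨a, rfl⟩
  refine ⟨S.α.symm a, ?_⟩
  have h := S.gnsUnitary_conj (S.α.symm a)
  rw [StarAlgEquiv.apply_symm_apply] at h
  change _ = S.gnsUnitary.conjStarAlgEquiv.symm (S.state.gnsStarAlgHom a)
  rw [← h, StarAlgEquiv.symm_apply_apply]
  rfl

/-- The canonical extension of the dynamics to `π_ω(A)''`. -/
def extendedDynamics (S : CStarDynamicalSystem) :
    S.vonNeumann.toStarSubalgebra ≃⋆ₐ[ℂ] S.vonNeumann.toStarSubalgebra :=
  doubleCommutantConj S.gnsImage S.gnsUnitary S.gnsUnitary_conj_mem S.gnsUnitary_symm_conj_mem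

/-- The canonical extension of the state to `π_ω(A)''`. -/
def extendedState (S : CStarDynamicalSystem) : S.vonNeumann.toStarSubalgebra →ₗ[ℂ] ℂ :=
  vectorFunctional S.vonNeumann.toStarSubalgebra S.cyclicVector

theorem extendedState_gns (S : CStarDynamicalSystem) (a : S.A)
    (h : S.state.gnsStarAlgHom a ∈ S.vonNeumann.toStarSubalgebra) :
    S.extendedState ⟨S.state.gnsStarAlgHom a, h⟩ = S.ω a := by
  change inner ℂ S.cyclicVector (S.state.gnsStarAlgHom a S.cyclicVector) = _
  simp [cyclicVector, PositiveLinearMap.preGNS_inner_def, state_apply]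

/-- Two C⋆-dynamical systems are conjugate if there is an isomorphism between the von Neumann
algebras of their GNS representations that intertwines the extended dynamics and states. -/
def Conjugate (S₁ S₂ : CStarDynamicalSystem) : Prop :=
  ∃ β : S₁.vonNeumann.toStarSubalgebra ≃⋆ₐ[ℂ] S₂.vonNeumann.toStarSubalgebra,
    (∀ x, β (S₁.extendedDynamics x) = S₂.extendedDynamics (β x)) ∧
      ∀ x, S₂.extendedState (β x) = S₁.extendedState x

end CStarDynamicalSystem

/-- The C⋆-dynamical system on the C⋆-algebra generated by `s`, with the dynamics implemented by
a unitary which permutes `s` and the state of an invariant unit vector. -/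
def vectorSystem {H : Type*} [NormedAddCommGroup H] [InnerProductSpace ℂ H] [CompleteSpace H]
    (s : Set (H →L[ℂ] H)) (U : H ≃ₗᵢ[ℂ] H) (h1 : ∀ x ∈ s, U.conjStarAlgEquiv x ∈ s)
    (h2 : ∀ x ∈ s, U.symm.conjStarAlgEquiv x ∈ s) (ξ : H) (hξ : ‖ξ‖ = 1) (hU : U ξ = ξ) :
    CStarDynamicalSystem where
  A := generatedCStarAlgebra s
  α := restrictConj s U h1 h2
  ω := vectorFunctional (generatedCStarAlgebra s) ξ
  ω_nonneg a := by
    change 0 ≤ inner ℂ ξ (ContinuousLinearMap.adjoint (a : H →L[ℂ] H) ((a : H →L[ℂ] H) ξ))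
    rw [ContinuousLinearMap.adjoint_inner_right, inner_self_eq_norm_sq_to_K]
    simp
  ω_one := by
    change inner ℂ ξ ξ = 1
    rw [inner_self_eq_norm_sq_to_K, hξ]
    simp
  ω_invariant a := by
    change inner ℂ ξ (U ((a : H →L[ℂ] H) (U.symm ξ))) = inner ℂ ξ ((a : H →L[ℂ] H) ξ)
    have h : U.symm ξ = ξ := by rw [LinearIsometryEquiv.symm_apply_eq, hU]
    rw [h]
    conv_lhs => rw [← hU]
    rw [LinearIsometryEquiv.inner_map_map, hU]

/-- A faithful normal tracial state of a von Neumann algebra. Normality is continuity for the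
ultraweak topology: the functional is `x ↦ ∑ n, ⟨ξ n, x (η n)⟩` with square summable `ξ`, `η`. -/
structure IsFaithfulNormalTracialState {H : Type*} [NormedAddCommGroup H] [InnerProductSpace ℂ H]
    [CompleteSpace H] (M : VonNeumannAlgebra H) (τ : M.toStarSubalgebra →ₗ[ℂ] ℂ) : Prop where
  map_one : τ 1 = 1
  nonneg : ∀ x, 0 ≤ τ (star x * x)
  faithful : ∀ x, τ (star x * x) = 0 → x = 0
  tracial : ∀ x y, τ (x * y) = τ (y * x)
  normal : ∃ ξ η : ℕ → H, Summable (fun n => ‖ξ n‖ ^ 2) ∧ Summable (fun n => ‖η n‖ ^ 2) ∧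
    ∀ x : M.toStarSubalgebra, HasSum (fun n => inner ℂ (ξ n) ((x : H →L[ℂ] H) (η n))) (τ x)

/-- A `II₁` factor: an infinite-dimensional von Neumann algebra with trivial centre that has a
faithful normal tracial state. -/
structure IsIIOneFactor {H : Type*} [NormedAddCommGroup H] [InnerProductSpace ℂ H]
    [CompleteSpace H] (M : VonNeumannAlgebra H) : Prop where
  center_trivial : ∀ z ∈ M, (∀ x ∈ M, z * x = x * z) → ∃ c : ℂ, z = c • 1
  infinite_dimensional : ¬ FiniteDimensional ℂ M.toStarSubalgebra
  exists_trace : ∃ τ, IsFaithfulNormalTracialState M τ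

namespace QFock

/-- The generators `a_i` of `R_q`. -/
def generatorsR (q : ℝ) (hq : |q| < 1) : Set (QFock q hq →L[ℂ] QFock q hq) :=
  Set.range (annihilator q hq)

/-- The generators `a_i + a_i⁺` of `G_q`. -/
def generatorsG (q : ℝ) (hq : |q| < 1) : Set (QFock q hq →L[ℂ] QFock q hq) :=
  Set.range fun i => annihilator q hq i + creator q hq i

/-- The C⋆-algebra `R_q`. -/
abbrev algebraR (q : ℝ) (hq : |q| < 1) : StarSubalgebra ℂ (QFock q hq →L[ℂ] QFock q hq) :=
  generatedCStarAlgebra (generatorsR q hq)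

/-- The C⋆-algebra `G_q`. -/
abbrev algebraG (q : ℝ) (hq : |q| < 1) : StarSubalgebra ℂ (QFock q hq →L[ℂ] QFock q hq) :=
  generatedCStarAlgebra (generatorsG q hq)

variable (q : ℝ) (hq : |q| < 1)

theorem norm_vacuum : ‖vacuum q hq‖ = 1 := by
  rw [vacuum, tensor, LinearIsometry.norm_map, norm_eq_sqrt_re_inner (𝕜 := ℂ), inner_preTensor,
    wordForm_same]
  simp [levelForm, inversions]

theorem secondQuantization_vacuum (T : OneParticle ≃ₗᵢ[ℂ] OneParticle) :
    secondQuantization q hq T (vacuum q hq) = vacuum q hq := by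
  rw [vacuum, secondQuantization_tensor]
  congr 1
  exact Sigma.ext rfl (heq_of_eq (funext fun k => Fin.elim0 k))

theorem shift_generatorsR : ∀ x ∈ generatorsR q hq,
    (secondQuantization q hq shift).conjStarAlgEquiv x ∈ generatorsR q hq := by
  rintro _ ⟨i, rfl⟩
  exact ⟨i + 1, (shiftAut_annihilator i).symm⟩

theorem shift_symm_generatorsR : ∀ x ∈ generatorsR q hq,
    (secondQuantization q hq shift).symm.conjStarAlgEquiv x ∈ generatorsR q hq := by
  rintro _ ⟨i, rfl⟩
  refine ⟨i - 1, ?_⟩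
  have h := shiftAut_annihilator (q := q) (hq := hq) (i - 1)
  rw [sub_add_cancel] at h
  rw [← h]
  exact ((shiftAut q hq).symm_apply_apply _).symm

theorem shiftAut_generatorG (i : ℤ) :
    shiftAut q hq (annihilator q hq i + creator q hq i) =
      annihilator q hq (i + 1) + creator q hq (i + 1) := by
  rw [map_add, shiftAut_annihilator, shiftAut_creator]

theorem shift_generatorsG : ∀ x ∈ generatorsG q hq,
    (secondQuantization q hq shift).conjStarAlgEquiv x ∈ generatorsG q hq := by
  rintro _ ⟨i, rfl⟩
  exact ⟨i + 1, (shiftAut_generatorG q hq i).symm⟩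

theorem shift_symm_generatorsG : ∀ x ∈ generatorsG q hq,
    (secondQuantization q hq shift).symm.conjStarAlgEquiv x ∈ generatorsG q hq := by
  rintro _ ⟨i, rfl⟩
  refine ⟨i - 1, ?_⟩
  have h := shiftAut_generatorG q hq (i - 1)
  rw [sub_add_cancel] at h
  change _ = _
  beta_reduce
  rw [← h]
  exact ((shiftAut q hq).symm_apply_apply _).symm

/-- The C⋆-dynamical system `(R_q, α, ω)`: the right shift `α(a_i) = a_{i+1}` and the vacuum
expectation `ω` on `R_q`. -/
def systemR : CStarDynamicalSystem :=
  vectorSystem (generatorsR q hq) (secondQuantization q hq shift) (shift_generatorsR q hq)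
    (shift_symm_generatorsR q hq) (vacuum q hq) (norm_vacuum q hq)
    (secondQuantization_vacuum q hq shift)

/-- The C⋆-dynamical system on `G_q` given by the restrictions of the shift and of the vacuum
expectation. -/
def systemG : CStarDynamicalSystem :=
  vectorSystem (generatorsG q hq) (secondQuantization q hq shift) (shift_generatorsG q hq)
    (shift_symm_generatorsG q hq) (vacuum q hq) (norm_vacuum q hq)
    (secondQuantization_vacuum q hq shift)

end QFock

end

noncomputable section

namespace QFock

variable {q : ℝ} {hq : |q| < 1}

/-! A conjugacy is in particular a ⋆-isomorphism of the two GNS von Neumann algebras, so it is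
enough to tell these algebras apart. The vacuum Ω is cyclic for both C⋆-algebras
(`denseRange_vacuum`), hence each GNS representation is unitarily equivalent to the identity
representation (`nonempty_vonNeumann_vectorSystem`), and the question becomes one about R_q'' and
G_q''.

R_q'' is everything: if y commutes with all a_i, then yΩ is annihilated by all a_i, so it is
orthogonal to every tensor of positive degree and equals cΩ; cyclicity then gives y = c.

For G_q'' the tool is the mirror image of the generators: operators that append and remove vectors
at the right end of a tensor. These right fields commute with the left ones (`field_rightField`) and
agree with them on Ω (`rightField_vacuum`). Moving a generator through Ω from one side to the other
makes the vacuum state a trace; the trace property and cyclicity make Ω separating. For a central z,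
the vector ξ = zΩ satisfies `field i ξ = rightField i ξ` for all i. Pairing this with e_i ⊗ t for t
of degree n + 1 and letting i tend to infinity gives ⟨t, ξ⟩ = q^(n+1) ⟨t, ξ⟩, so ξ is a multiple of
Ω and z is a scalar (`inner_tensor_eq_zero_of_field_eq`).

Finally, B(H) with H infinite-dimensional has no faithful tracial state (`no_faithful_trace`), so it
is not isomorphic to G_q''. -/

/-! ### Creators and annihilators on the completed Fock space -/

theorem adjoint_creation_toFock (x : OneParticle) (ξ : PreFock q hq) :
    ContinuousLinearMap.adjoint (creation q hq x) (toFock q hq ξ) =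
      toFock q hq (preAnnihilation x ξ) := by
  refine ext_inner_left ℂ fun η => ?_
  rw [ContinuousLinearMap.adjoint_inner_right]
  induction η using fock_induction with
  | hP => exact isClosed_eq (by fun_prop) (by fun_prop)
  | h η => rw [creation_toFock, LinearIsometry.inner_map_map, LinearIsometry.inner_map_map,
      inner_preCreation]

theorem adjoint_creation_tensor (x : OneParticle) (w : Word) :
    ContinuousLinearMap.adjoint (creation q hq x) (tensor q hq w) =
      toFock q hq (annWord q hq x w) := by
  rw [tensor, adjoint_creation_toFock, preAnnihilation, preLift_preTensor]

theorem adjoint_creation_vacuum (x : OneParticle) :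
    ContinuousLinearMap.adjoint (creation q hq x) (vacuum q hq) = 0 := by
  rw [vacuum, adjoint_creation_tensor]
  simp [annWord]

/-- Words are formal symbols, so tensors become multilinear only once null vectors are identified.
After taking adjoints the one-particle vector enters only through inner products in `annWord`, where
additivity is visible. -/
theorem creation_add (x y : OneParticle) :
    creation q hq (x + y) = creation q hq x + creation q hq y := by
  apply (ContinuousLinearMap.adjoint (𝕜 := ℂ) (E := QFock q hq) (F := QFock q hq)).injective
  refine ext_tensor fun w => ?_
  rw [map_add, add_apply]
  simp only [adjoint_creation_tensor, ← map_add]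
  congr 1
  obtain ⟨n, f⟩ := w
  cases n with
  | zero => simp [annWord]
  | succ n => simp [annWord, mul_add, add_smul, Finset.sum_add_distrib]

theorem creation_smul (c : ℂ) (x : OneParticle) :
    creation q hq (c • x) = c • creation q hq x := by
  apply (ContinuousLinearMap.adjoint (𝕜 := ℂ) (E := QFock q hq) (F := QFock q hq)).injective
  refine ext_tensor fun w => ?_
  rw [LinearIsometryEquiv.map_smulₛₗ, smul_apply]
  simp only [adjoint_creation_tensor, ← map_smul]
  congr 1
  obtain ⟨n, f⟩ := w
  cases n with
  | zero => simp [annWord]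
  | succ n =>
    simp only [annWord, inner_smul_left, Finset.smul_sum, smul_smul]
    refine Finset.sum_congr rfl fun k _ => ?_
    congr 1
    ring

theorem norm_creation_le (x : OneParticle) :
    ‖creation q hq x‖ ≤ (Real.sqrt (1 - |q|))⁻¹ * ‖x‖ := by
  have h1 : 0 < 1 - |q| := by linarith
  refine ContinuousLinearMap.opNorm_le_bound _ (by positivity) fun ξ => ?_
  induction ξ using fock_induction with
  | hP => exact isClosed_le (by fun_prop) (by fun_prop)
  | h ξ =>
    rw [creation_toFock, LinearIsometry.norm_map, LinearIsometry.norm_map]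
    refine (norm_preCreation_le x ξ).trans (le_of_eq ?_)
    rw [Real.sqrt_div (sq_nonneg _), Real.sqrt_sq (norm_nonneg _)]
    ring

/-- The creator as a continuous linear function of the one-particle vector. -/
def creationL (q : ℝ) (hq : |q| < 1) : OneParticle →L[ℂ] QFock q hq →L[ℂ] QFock q hq :=
  LinearMap.mkContinuous
    { toFun := creation q hq
      map_add' := creation_add
      map_smul' := creation_smul } _ norm_creation_le

theorem mem_of_forall_e {K : Submodule ℂ OneParticle} (hK : IsClosed (K : Set OneParticle))
    (h : ∀ i, e i ∈ K) (x : OneParticle) : x ∈ K := by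
  refine hK.mem_of_tendsto (lp.hasSum_single ENNReal.ofNat_ne_top x)
    (Filter.Eventually.of_forall fun s => sum_mem fun i _ => ?_)
  have : lp.single 2 i (x i) = x i • e i := by
    rw [e, ← lp.single_smul, smul_eq_mul, mul_one]
  rw [this]
  exact K.smul_mem _ (h i)

/-- The generators involve only the basis vectors e_i, while tensors have arbitrary factors. Since x
↦ a⁺(x)η is linear and continuous, the preimage of K is a closed subspace of ℓ²(ℤ), and the basis
suffices. -/
theorem creation_apply_mem {K : Submodule ℂ (QFock q hq)} (hK : IsClosed (K : Set (QFock q hq)))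
    {η : QFock q hq} (h : ∀ i, creation q hq (e i) η ∈ K) (x : OneParticle) :
    creation q hq x η ∈ K := by
  let T : OneParticle →L[ℂ] QFock q hq := (creationL q hq).flip η
  exact mem_of_forall_e (K := K.comap T.toLinearMap) (hK.preimage T.continuous) h x

theorem inner_e (i j : ℤ) : inner ℂ (e i) (e j) = if i = j then (1 : ℂ) else 0 := by
  rw [e, e, lp.inner_single_left]
  by_cases h : i = j
  · subst h; simp
  · simp [h, lp.single_apply]

theorem norm_e (i : ℤ) : ‖e i‖ = 1 := by
  rw [norm_eq_sqrt_re_inner (𝕜 := ℂ), inner_e]; simp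

theorem tendsto_inner_e (x : OneParticle) :
    Filter.Tendsto (fun i => inner ℂ (e i) x) Filter.cofinite (nhds (0 : ℂ)) := by
  have h := lp.memℓp x
  rw [memℓp_gen_iff (by norm_num)] at h
  have h2 := h.tendsto_cofinite_zero
  have h3 : ∀ i, inner ℂ (e i) x = x i := fun i => by rw [e, lp.inner_single_left]; simp
  simp only [h3]
  rw [tendsto_zero_iff_norm_tendsto_zero]
  have h4 := (Real.continuous_sqrt.tendsto 0).comp h2
  simpa [Function.comp_def, Real.sqrt_sq] using h4

theorem tensor_induction {K : Submodule ℂ (QFock q hq)} (hK : IsClosed (K : Set (QFock q hq)))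
    (h : ∀ w, tensor q hq w ∈ K) (ξ : QFock q hq) : ξ ∈ K := by
  induction ξ using fock_induction with
  | hP => exact hK
  | h ξ =>
    induction ξ using pre_induction with
    | h0 => simp
    | hadd a b ha hb => rw [map_add]; exact add_mem ha hb
    | hsmul c w => rw [map_smul]; exact K.smul_mem c (h w)

theorem commutation (x y : OneParticle) (ξ : QFock q hq) :
    ContinuousLinearMap.adjoint (creation q hq x) (creation q hq y ξ) =
      (inner ℂ x y : ℂ) • ξ +
        (q : ℂ) • creation q hq y (ContinuousLinearMap.adjoint (creation q hq x) ξ) := by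
  have h := ext_tensor (q := q) (hq := hq)
    (A := ContinuousLinearMap.adjoint (creation q hq x) ∘L creation q hq y)
    (B := (inner ℂ x y : ℂ) • ContinuousLinearMap.id ℂ _ +
      (q : ℂ) • (creation q hq y ∘L ContinuousLinearMap.adjoint (creation q hq x))) fun w => by
    simp only [ContinuousLinearMap.comp_apply, add_apply, smul_apply, ContinuousLinearMap.id_apply,
      tensor, creation_toFock, adjoint_creation_toFock, pre_commutation, map_add, map_smul]
  exact DFunLike.congr_fun h ξ

theorem norm_adjoint_creation_e_le (i : ℤ) :
    ‖ContinuousLinearMap.adjoint (creation q hq (e i))‖ ≤ (Real.sqrt (1 - |q|))⁻¹ := by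
  rw [LinearIsometryEquiv.norm_map]
  simpa [norm_e] using norm_creation_le (q := q) (hq := hq) (e i)

/-- The annihilators tend strongly to zero along the basis. -/
theorem tendsto_adjoint_creation_e (ξ : QFock q hq) :
    Filter.Tendsto (fun i => ContinuousLinearMap.adjoint (creation q hq (e i)) ξ)
      Filter.cofinite (nhds 0) := by
  have h1 : 0 < 1 - |q| := by linarith
  let K : Submodule ℂ (QFock q hq) :=
    { carrier := {ξ | Filter.Tendsto
        (fun i => ContinuousLinearMap.adjoint (creation q hq (e i)) ξ) Filter.cofinite (nhds 0)}
      add_mem' := fun {a b} ha hb => by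
        simp only [Set.mem_ofPred_eq, map_add] at *; simpa using ha.add hb
      zero_mem' := by simp
      smul_mem' := fun c a ha => by
        simp only [Set.mem_ofPred_eq, map_smul] at *; simpa using ha.const_smul c }
  -- The annihilators are bounded by C uniformly in i, so strong convergence to zero passes to
  -- limits of vectors. In the choice of η below, C + 1 makes the denominator positive.
  have hK : IsClosed (K : Set (QFock q hq)) := by
    refine isClosed_of_closure_subset fun ξ hξ => ?_
    change Filter.Tendsto _ _ _
    rw [Metric.tendsto_nhds]
    intro ε hε
    set C := (Real.sqrt (1 - |q|))⁻¹
    have hC : 0 ≤ C := by positivity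
    obtain ⟨η, hη, hd⟩ := Metric.mem_closure_iff.1 hξ (ε / (2 * (C + 1))) (by positivity)
    filter_upwards [Metric.tendsto_nhds.1 hη (ε / 2) (by positivity)] with i hi
    rw [dist_zero_right] at hi ⊢
    have h2 : ‖ContinuousLinearMap.adjoint (creation q hq (e i)) (ξ - η)‖ ≤ C * ‖ξ - η‖ :=
      ContinuousLinearMap.le_of_opNorm_le _ (norm_adjoint_creation_e_le i) _
    rw [dist_eq_norm, lt_div_iff₀ (by positivity)] at hd
    rw [← sub_add_cancel ξ η, map_add]
    refine (norm_add_le _ _).trans_lt ?_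
    nlinarith [norm_nonneg (ξ - η)]
  refine tensor_induction hK (fun w => ?_) ξ
  change Filter.Tendsto _ _ _
  simp only [adjoint_creation_tensor]
  obtain ⟨n, f⟩ := w
  cases n with
  | zero => simp [annWord]
  | succ n =>
    simp only [annWord, map_sum, map_smul]
    -- Finitely many fixed tensors occur, each with a coefficient q^k ⟨e_i, f_k⟩ that tends to zero.
    rw [← Finset.sum_const_zero (s := (Finset.univ : Finset (Fin (n + 1))))]
    refine tendsto_finsetSum _ fun k _ => ?_
    have := ((tendsto_inner_e (f k)).const_mul ((q : ℂ) ^ (k : ℕ))).smul_const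
      (toFock q hq (preTensor q hq ⟨n, k.removeNth f⟩))
    simpa using this

/-! ### Reversal of tensors -/

/-- Reversing both places and values turns the inversion at (a, b) into one at (rev b, rev a). This
is what makes the reversal of tensors isometric. -/
theorem inversions_rev {n : ℕ} (π : Equiv.Perm (Fin n)) :
    inversions (Fin.revPerm * π * Fin.revPerm) = inversions π := by
  unfold inversions
  refine Finset.card_bij' (fun p _ => (p.2.rev, p.1.rev)) (fun p _ => (p.2.rev, p.1.rev))
    ?_ ?_ ?_ ?_ <;> simp

theorem levelForm_rev {n : ℕ} (f g : Fin n → OneParticle) :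
    levelForm q (f ∘ Fin.rev) (g ∘ Fin.rev) = levelForm q f g := by
  unfold levelForm
  refine Fintype.sum_equiv ((Equiv.mulLeft Fin.revPerm).trans (Equiv.mulRight Fin.revPerm)) _ _
    fun π => ?_
  simp only [Equiv.trans_apply, Equiv.coe_mulLeft, Equiv.coe_mulRight, inversions_rev]
  congr 1
  exact Fintype.prod_equiv Fin.revPerm _ _ fun k => by simp

/-- The reversed word. -/
def reverseWord (w : Word) : Word := ⟨w.1, w.2 ∘ Fin.rev⟩

theorem reverseWord_reverseWord (w : Word) : reverseWord (reverseWord w) = w := by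
  obtain ⟨n, f⟩ := w
  simp [reverseWord, Function.comp_assoc, Fin.rev_involutive.comp_self]

theorem wordForm_reverseWord (w v : Word) :
    wordForm q (reverseWord w) (reverseWord v) = wordForm q w v := by
  obtain ⟨n, f⟩ := w
  obtain ⟨m, g⟩ := v
  by_cases h : m = n
  · subst h
    rw [reverseWord, reverseWord, wordForm_same, wordForm_same, levelForm_rev]
  · simp [wordForm, reverseWord, h]

/-- Reversal of tensors on the pre-Hilbert space. -/
def preReverse : PreFock q hq →ₗ[ℂ] PreFock q hq :=
  preLift fun w => preTensor q hq (reverseWord w)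

theorem preReverse_preTensor (w : Word) :
    preReverse (preTensor q hq w) = preTensor q hq (reverseWord w) := preLift_preTensor _ w

theorem preReverse_preReverse (ξ : PreFock q hq) : preReverse (preReverse ξ) = ξ := by
  induction ξ using pre_induction with
  | h0 => simp
  | hadd a b ha hb => simp only [map_add, ha, hb]
  | hsmul c w => simp only [map_smul, preReverse_preTensor, reverseWord_reverseWord]

theorem inner_preReverse (ξ η : PreFock q hq) :
    (inner ℂ (preReverse ξ) (preReverse η) : ℂ) = inner ℂ ξ η := by
  induction ξ using pre_induction with
  | h0 => simp
  | hadd a b ha hb => simp only [inner_add_left, map_add, ha, hb]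
  | hsmul c w =>
    induction η using pre_induction with
    | h0 => simp
    | hadd a b ha hb => simp only [inner_add_right, map_add, ha, hb]
    | hsmul d v =>
      simp only [map_smul, inner_smul_left, inner_smul_right, preReverse_preTensor,
        inner_preTensor, wordForm_reverseWord]

/-- Reversal of tensors, a unitary of the `q`-Fock space. -/
def reversal (q : ℝ) (hq : |q| < 1) : QFock q hq ≃ₗᵢ[ℂ] QFock q hq :=
  (completionUnitary
    { toLinearEquiv := LinearEquiv.ofLinearMap preReverse preReverse
        (LinearMap.ext preReverse_preReverse) (LinearMap.ext preReverse_preReverse)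
      norm_map' := fun ξ => by
        change ‖preReverse ξ‖ = ‖ξ‖
        rw [norm_eq_sqrt_re_inner (𝕜 := ℂ), norm_eq_sqrt_re_inner (𝕜 := ℂ), inner_preReverse] } :
    UniformSpace.Completion (PreFock q hq) ≃ₗᵢ[ℂ] UniformSpace.Completion (PreFock q hq))

theorem reversal_toFock (ξ : PreFock q hq) :
    reversal q hq (toFock q hq ξ) = toFock q hq (preReverse ξ) :=
  completionUnitary_coe _ ξ

theorem reversal_tensor (w : Word) :
    reversal q hq (tensor q hq w) = tensor q hq (reverseWord w) := by
  rw [tensor, reversal_toFock, preReverse_preTensor, tensor]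

theorem reversal_reversal (ξ : QFock q hq) : reversal q hq (reversal q hq ξ) = ξ := by
  induction ξ using fock_induction with
  | hP => exact isClosed_eq (by fun_prop) (by fun_prop)
  | h ξ => rw [reversal_toFock, reversal_toFock, preReverse_preReverse]

theorem reversal_symm : (reversal q hq).symm = reversal q hq :=
  LinearIsometryEquiv.ext fun ξ => by
    rw [LinearIsometryEquiv.symm_apply_eq, reversal_reversal]

theorem reversal_vacuum : reversal q hq (vacuum q hq) = vacuum q hq := by
  rw [vacuum, reversal_tensor]
  congr 1

/-- The operator that appends a vector on the right of a tensor. -/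
def rightCreation (q : ℝ) (hq : |q| < 1) (x : OneParticle) : QFock q hq →L[ℂ] QFock q hq :=
  (reversal q hq).conjStarAlgEquiv (creation q hq x)

theorem rightCreation_apply (x : OneParticle) (ξ : QFock q hq) :
    rightCreation q hq x ξ = reversal q hq (creation q hq x (reversal q hq ξ)) := by
  rw [rightCreation, LinearIsometryEquiv.conjStarAlgEquiv_apply_apply, reversal_symm]

theorem adjoint_rightCreation_apply (x : OneParticle) (ξ : QFock q hq) :
    ContinuousLinearMap.adjoint (rightCreation q hq x) ξ =
      reversal q hq (ContinuousLinearMap.adjoint (creation q hq x) (reversal q hq ξ)) := by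
  rw [← ContinuousLinearMap.star_eq_adjoint, rightCreation]
  erw [← map_star]
  rw [LinearIsometryEquiv.conjStarAlgEquiv_apply_apply, reversal_symm,
    ContinuousLinearMap.star_eq_adjoint]

theorem rightCreation_tensor (x : OneParticle) {n : ℕ} (f : Fin n → OneParticle) :
    rightCreation q hq x (tensor q hq ⟨n, f⟩) =
      tensor q hq ⟨n + 1, (Fin.snoc f x : Fin (n + 1) → OneParticle)⟩ := by
  rw [rightCreation_apply, reversal_tensor, creation_tensor, reversal_tensor]
  simp only [reverseWord]
  rw [Fin.cons_comp_rev, Function.comp_assoc, Fin.rev_involutive.comp_self, Function.comp_id]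

theorem rightCreation_vacuum (x : OneParticle) :
    rightCreation q hq x (vacuum q hq) = creation q hq x (vacuum q hq) := by
  rw [vacuum, rightCreation_tensor, creation_tensor]
  congr 1
  exact Sigma.ext rfl (heq_of_eq (funext fun k => by
    obtain rfl : k = (0 : Fin 1) := Subsingleton.elim (α := Fin 1) _ _
    rfl))

theorem adjoint_rightCreation_vacuum (x : OneParticle) :
    ContinuousLinearMap.adjoint (rightCreation q hq x) (vacuum q hq) = 0 := by
  rw [adjoint_rightCreation_apply, reversal_vacuum, adjoint_creation_vacuum, map_zero]

theorem rightCreation_creation (x y : OneParticle) :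
    rightCreation q hq y * creation q hq x = creation q hq x * rightCreation q hq y := by
  refine ext_tensor fun w => ?_
  obtain ⟨n, f⟩ := w
  simp only [mul_apply_eq_comp, creation_tensor, rightCreation_tensor,
    Fin.cons_snoc_eq_snoc_cons]

/-- Appending y adds one summand to the annihilation formula, the one that removes the last factor.
That factor stands at place n (counted from zero), whence the weight q^n and the restriction to
tensors of fixed degree. -/
theorem adjoint_creation_rightCreation (x y : OneParticle) {n : ℕ} (f : Fin n → OneParticle) :
    ContinuousLinearMap.adjoint (creation q hq x) (rightCreation q hq y (tensor q hq ⟨n, f⟩)) =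
      rightCreation q hq y (ContinuousLinearMap.adjoint (creation q hq x) (tensor q hq ⟨n, f⟩)) +
        ((q : ℂ) ^ n * inner ℂ x y) • tensor q hq ⟨n, f⟩ := by
  rw [rightCreation_tensor, adjoint_creation_tensor, adjoint_creation_tensor]
  simp only [annWord]
  rw [Fin.sum_univ_castSucc, map_add]
  congr 1
  · cases n with
    | zero => simp
    | succ n =>
      simp only [map_sum, map_smul]
      refine Finset.sum_congr rfl fun k _ => ?_
      change _ = _ • rightCreation q hq y (tensor q hq _)
      rw [rightCreation_tensor, Fin.snoc_castSucc, Fin.val_castSucc, tensor]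
      congr 4
      funext j
      refine Fin.lastCases ?_ (fun j => ?_) j
      · simp [Fin.removeNth]
      · simp [Fin.removeNth]
  · rw [map_smul, Fin.val_last, Fin.snoc_last, tensor]
    congr 4
    funext j
    simp [Fin.removeNth]

theorem adjoint_rightCreation_creation (x y : OneParticle) {n : ℕ} (f : Fin n → OneParticle) :
    ContinuousLinearMap.adjoint (rightCreation q hq x) (creation q hq y (tensor q hq ⟨n, f⟩)) =
      creation q hq y (ContinuousLinearMap.adjoint (rightCreation q hq x) (tensor q hq ⟨n, f⟩)) +
        ((q : ℂ) ^ n * inner ℂ x y) • tensor q hq ⟨n, f⟩ := by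
  have h := congrArg (reversal q hq)
    (adjoint_creation_rightCreation (q := q) (hq := hq) x y (f ∘ Fin.rev))
  have h1 : tensor q hq ⟨n, f ∘ Fin.rev⟩ = reversal q hq (tensor q hq ⟨n, f⟩) := by
    rw [reversal_tensor, reverseWord]
  rw [h1] at h
  simpa only [map_add, map_smul, rightCreation_apply, reversal_reversal,
    adjoint_rightCreation_apply] using h

/-! ### Left and right field operators -/

/-- The generators `a_i + a_i⁺`. -/
def field (q : ℝ) (hq : |q| < 1) (i : ℤ) : QFock q hq →L[ℂ] QFock q hq :=
  annihilator q hq i + creator q hq i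

/-- The mirror images of the generators `a_i + a_i⁺`. -/
def rightField (q : ℝ) (hq : |q| < 1) (i : ℤ) : QFock q hq →L[ℂ] QFock q hq :=
  ContinuousLinearMap.adjoint (rightCreation q hq (e i)) + rightCreation q hq (e i)

theorem star_field (i : ℤ) : star (field q hq i) = field q hq i := by
  rw [field, annihilator, ← ContinuousLinearMap.star_eq_adjoint, star_add, star_star, add_comm]

theorem star_rightField (i : ℤ) : star (rightField q hq i) = rightField q hq i := by
  rw [rightField, ← ContinuousLinearMap.star_eq_adjoint, star_add, star_star, add_comm]

/-- On the empty tensor the annihilating parts vanish, and prepending is the same as appending. -/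
theorem rightField_vacuum (i : ℤ) :
    rightField q hq i (vacuum q hq) = field q hq i (vacuum q hq) := by
  simp only [rightField, field, annihilator, creator, add_apply,
    adjoint_rightCreation_vacuum, adjoint_creation_vacuum, rightCreation_vacuum]

/-- Prepending commutes with appending, and by taking adjoints the two annihilating parts commute.
Each of the two products contains one mixed correction, q^n ⟨e_i, e_j⟩ in the first and q^n ⟨e_j,
e_i⟩ in the second; these agree because the inner products of basis vectors are real. -/
theorem field_rightField (i j : ℤ) :
    field q hq i * rightField q hq j = rightField q hq j * field q hq i := by
  have h1 := rightCreation_creation (q := q) (hq := hq) (e i) (e j)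
  have h2 := congrArg star h1
  rw [star_mul, star_mul] at h2
  simp only [ContinuousLinearMap.star_eq_adjoint] at h2
  refine ext_tensor fun w => ?_
  obtain ⟨n, f⟩ := w
  have h1' := DFunLike.congr_fun h1 (tensor q hq ⟨n, f⟩)
  have h2' := DFunLike.congr_fun h2 (tensor q hq ⟨n, f⟩)
  have hij : (inner ℂ (e j) (e i) : ℂ) = inner ℂ (e i) (e j) := by
    rw [inner_e, inner_e]; simp only [eq_comm]
  simp only [mul_apply_eq_comp] at h1' h2'
  simp only [mul_apply_eq_comp, field, rightField, annihilator, creator,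
    add_apply, map_add, adjoint_creation_rightCreation,
    adjoint_rightCreation_creation, h1', h2', hij]
  abel

end QFock

/-! ### Commutants, traces and the GNS representation of a vector state -/

section OperatorAlgebras

variable {H : Type*} [NormedAddCommGroup H] [InnerProductSpace ℂ H] [CompleteSpace H]

theorem mem_doubleCommutant_iff {S : StarSubalgebra ℂ (H →L[ℂ] H)} {x : H →L[ℂ] H} :
    x ∈ doubleCommutant S ↔ ∀ y ∈ Set.centralizer (S : Set (H →L[ℂ] H)), y * x = x * y := by
  rw [← SetLike.mem_coe, coe_doubleCommutant]
  rfl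

theorem subset_doubleCommutant {S : StarSubalgebra ℂ (H →L[ℂ] H)} {x : H →L[ℂ] H} (hx : x ∈ S) :
    x ∈ doubleCommutant S :=
  mem_doubleCommutant_iff.2 fun _ hy => (hy x hx).symm

theorem subset_generatedCStarAlgebra {s : Set (H →L[ℂ] H)} {x : H →L[ℂ] H} (hx : x ∈ s) :
    x ∈ generatedCStarAlgebra s :=
  StarSubalgebra.le_topologicalClosure _ (StarAlgebra.subset_adjoin ℂ s hx)

/-- The operators commuting with both y and its adjoint form a norm-closed ⋆-algebra, so only
generators need checking. -/
theorem mem_centralizer_generatedCStarAlgebra {s : Set (H →L[ℂ] H)} {y : H →L[ℂ] H}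
    (h : ∀ x ∈ s, x * y = y * x) (h' : ∀ x ∈ s, x * star y = star y * x) :
    y ∈ Set.centralizer (generatedCStarAlgebra s : Set (H →L[ℂ] H)) := by
  have h1 : StarAlgebra.adjoin ℂ s ≤ StarSubalgebra.centralizer ℂ {y} :=
    StarAlgebra.adjoin_le fun x hx => by
      rw [SetLike.mem_coe, StarSubalgebra.mem_centralizer_iff]
      rintro g rfl
      exact ⟨(h x hx).symm, (h' x hx).symm⟩
  have h2 : generatedCStarAlgebra s ≤ StarSubalgebra.centralizer ℂ {y} :=
    StarSubalgebra.topologicalClosure_minimal h1 (by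
      rw [StarSubalgebra.coe_centralizer]
      exact Set.isClosed_centralizer _)
  intro x hx
  exact ((StarSubalgebra.mem_centralizer_iff ℂ).1 (h2 hx) y rfl).1.symm

/-- There is no faithful tracial state on all bounded operators of an infinite-dimensional
Hilbert space. -/
theorem no_faithful_trace {v : ℕ → H} (hv : Orthonormal ℂ v) (τ : (H →L[ℂ] H) →ₗ[ℂ] ℂ)
    (h1 : τ 1 = 1) (hpos : ∀ x, 0 ≤ τ (star x * x)) (hf : ∀ x, τ (star x * x) = 0 → x = 0)
    (htr : ∀ x y, τ (x * y) = τ (y * x)) : False := by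
  -- Matrix units for the orthonormal sequence.
  set E : ℕ → ℕ → H →L[ℂ] H := fun i j => InnerProductSpace.rankOne ℂ (v i) (v j) with hE
  have hmul : ∀ i j k l, E i j * E k l = if j = k then E i l else 0 := by
    intro i j k l
    ext x
    simp only [hE, mul_apply_eq_comp, InnerProductSpace.rankOne_apply, map_smul,
      orthonormal_iff_ite.1 hv]
    split_ifs <;> simp
  have hstar : ∀ i j, star (E i j) = E j i := fun i j => by
    rw [ContinuousLinearMap.star_eq_adjoint, InnerProductSpace.adjoint_rankOne]
  -- The diagonal units are Murray–von Neumann equivalent projections, so a trace cannot distinguish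
  -- them.
  have hconst : ∀ i, τ (E i i) = τ (E 0 0) := fun i => by
    have := htr (E i 0) (E 0 i)
    simpa [hmul] using this
  have hp0 : 0 ≤ τ (E 0 0) := by simpa [hstar, hmul] using hpos (E 0 0)
  -- The sum P of n diagonal units is a projection; so is 1 - P, and positivity of τ (1 - P) bounds
  -- τ P by 1.
  have hsum : ∀ n : ℕ, (n : ℂ) * τ (E 0 0) ≤ 1 := by
    intro n
    set P := ∑ i ∈ Finset.range n, E i i with hP
    have hPs : star P = P := by simp [hP, hstar]
    have hPP : P * P = P := by
      simp only [hP, Finset.sum_mul, Finset.mul_sum, hmul]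
      refine Finset.sum_congr rfl fun i hi => ?_
      simp only [Finset.sum_ite_eq', hi, if_true]
    have hτ : τ P = n * τ (E 0 0) := by
      simp [hP, map_sum, hconst]
    have h2 := hpos (1 - P)
    have h3 : star (1 - P) * (1 - P) = 1 - P := by
      rw [star_sub, star_one, hPs, mul_sub, mul_one, sub_mul, one_mul, hPP, sub_self, sub_zero]
    rw [h3, map_sub, h1, hτ] at h2
    exact sub_nonneg.1 h2
  have hzero : τ (E 0 0) = 0 := by
    obtain ⟨t, ht⟩ : ∃ t : ℝ, τ (E 0 0) = t := ⟨_, Complex.eq_re_of_ofReal_le hp0⟩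
    rw [ht] at hp0 hsum ⊢
    have ht0 : 0 ≤ t := by exact_mod_cast hp0
    have hn : ∀ n : ℕ, n * t ≤ 1 := fun n => by exact_mod_cast hsum n
    rcases ht0.eq_or_lt with h | h
    · simp [← h]
    · obtain ⟨n, hn'⟩ := exists_nat_gt (1 / t)
      rw [div_lt_iff₀ h] at hn'
      exact absurd (hn n) (not_le.2 hn')
  have hE0 : E 0 0 = 0 := hf _ (by rw [hstar, hmul, if_pos rfl, hzero])
  exact InnerProductSpace.rankOne_ne_zero (hv.ne_zero 0) (hv.ne_zero 0) hE0

/-- A trace pulled back along an isomorphism would contradict `no_faithful_trace`. The pullback is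
purely algebraic, so no continuity of the isomorphism is required. -/
theorem isEmpty_starAlgEquiv_of_trace {K : Type*} [NormedAddCommGroup K] [InnerProductSpace ℂ K]
    [CompleteSpace K] {M : VonNeumannAlgebra H} {N : VonNeumannAlgebra K}
    (hM : (M : Set (H →L[ℂ] H)) = Set.univ) {v : ℕ → H} (hv : Orthonormal ℂ v)
    {τ : N.toStarSubalgebra →ₗ[ℂ] ℂ} (hτ : IsFaithfulNormalTracialState N τ) :
    IsEmpty (M.toStarSubalgebra ≃⋆ₐ[ℂ] N.toStarSubalgebra) := by
  refine ⟨fun β => ?_⟩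
  have hmem : ∀ x, x ∈ M.toStarSubalgebra := fun x => by
    change x ∈ (M : Set (H →L[ℂ] H))
    rw [hM]; trivial
  let ι : (H →L[ℂ] H) →⋆ₐ[ℂ] M.toStarSubalgebra :=
    { toFun := fun x => ⟨x, hmem x⟩
      map_one' := rfl
      map_mul' := fun _ _ => rfl
      map_zero' := rfl
      map_add' := fun _ _ => rfl
      commutes' := fun _ => rfl
      map_star' := fun _ => rfl }
  let φ : (H →L[ℂ] H) →⋆ₐ[ℂ] N.toStarSubalgebra := (β : M.toStarSubalgebra →⋆ₐ[ℂ] _).comp ι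
  refine no_faithful_trace hv (τ ∘ₗ φ.toAlgHom.toLinearMap) ?_ ?_ ?_ ?_
  · change τ (φ 1) = 1
    rw [map_one, hτ.map_one]
  · intro x
    change 0 ≤ τ (φ (star x * x))
    rw [map_mul, map_star]
    exact hτ.nonneg _
  · intro x hx
    change τ (φ (star x * x)) = 0 at hx
    rw [map_mul, map_star] at hx
    have h0 := hτ.faithful _ hx
    have h1 : ι x = 0 := β.injective (h0.trans (map_zero β).symm)
    exact congrArg Subtype.val h1
  · intro x y
    change τ (φ (x * y)) = τ (φ (y * x))
    rw [map_mul φ, map_mul φ, hτ.tracial]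

/-- A unitary that carries one ⋆-algebra onto another one induces an isomorphism of the double
commutants. -/
def doubleCommutantCongr {K : Type*} [NormedAddCommGroup K] [InnerProductSpace ℂ K]
    [CompleteSpace K] {S : StarSubalgebra ℂ (H →L[ℂ] H)} {T : StarSubalgebra ℂ (K →L[ℂ] K)}
    (U : H ≃ₗᵢ[ℂ] K) (h : ∀ x, x ∈ S ↔ U.conjStarAlgEquiv x ∈ T) :
    (doubleCommutant S).toStarSubalgebra ≃⋆ₐ[ℂ] (doubleCommutant T).toStarSubalgebra :=
  have hc : ∀ x, x ∈ Set.centralizer (S : Set (H →L[ℂ] H)) ↔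
      U.conjStarAlgEquiv x ∈ Set.centralizer (T : Set (K →L[ℂ] K)) := fun x => by
    constructor
    · intro hx y hy
      obtain ⟨y, rfl⟩ : ∃ z, U.conjStarAlgEquiv z = y := U.conjStarAlgEquiv.surjective y
      rw [← map_mul, ← map_mul, hx y ((h y).2 hy)]
    · intro hx y hy
      apply U.conjStarAlgEquiv.injective
      rw [map_mul, map_mul]
      exact hx _ ((h y).1 hy)
  have hd : ∀ x, x ∈ doubleCommutant S ↔ U.conjStarAlgEquiv x ∈ doubleCommutant T := fun x => by
    rw [mem_doubleCommutant_iff, mem_doubleCommutant_iff]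
    constructor
    · intro hx y hy
      obtain ⟨y, rfl⟩ : ∃ z, U.conjStarAlgEquiv z = y := U.conjStarAlgEquiv.surjective y
      rw [← map_mul, ← map_mul, hx y ((hc y).2 hy)]
    · intro hx y hy
      apply U.conjStarAlgEquiv.injective
      rw [map_mul, map_mul]
      exact hx _ ((hc y).1 hy)
  { toFun := fun x => ⟨U.conjStarAlgEquiv x, (hd x).1 x.2⟩
    invFun := fun x => ⟨U.conjStarAlgEquiv.symm x, (hd _).2 (by
      rw [StarAlgEquiv.apply_symm_apply]; exact x.2)⟩
    left_inv := fun x => Subtype.ext (U.conjStarAlgEquiv.symm_apply_apply x)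
    right_inv := fun x => Subtype.ext (U.conjStarAlgEquiv.apply_symm_apply x)
    map_mul' := fun x y => Subtype.ext (map_mul U.conjStarAlgEquiv (x : H →L[ℂ] H) y)
    map_add' := fun x y => Subtype.ext (map_add U.conjStarAlgEquiv (x : H →L[ℂ] H) y)
    map_star' := fun x => Subtype.ext (U.conjStarAlgEquiv.map_star' (x : H →L[ℂ] H))
    map_smul' := fun c x => Subtype.ext (map_smul U.conjStarAlgEquiv c (x : H →L[ℂ] H)) }

/-- The GNS representation of the vector state of a cyclic vector is the identity representation
up to unitary equivalence. -/
theorem nonempty_vonNeumann_vectorSystem (s : Set (H →L[ℂ] H)) (U : H ≃ₗᵢ[ℂ] H)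
    (h1 : ∀ x ∈ s, U.conjStarAlgEquiv x ∈ s) (h2 : ∀ x ∈ s, U.symm.conjStarAlgEquiv x ∈ s)
    (ξ : H) (hξ : ‖ξ‖ = 1) (hU : U ξ = ξ)
    (hc : DenseRange fun a : generatedCStarAlgebra s => (a : H →L[ℂ] H) ξ) :
    Nonempty ((vectorSystem s U h1 h2 ξ hξ hU).vonNeumann.toStarSubalgebra ≃⋆ₐ[ℂ]
      (doubleCommutant (generatedCStarAlgebra s)).toStarSubalgebra) := by
  let D := vectorSystem s U h1 h2 ξ hξ hU
  let A := generatedCStarAlgebra s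
  let emb : D.A → H →L[ℂ] H := fun a : A => (a : H →L[ℂ] H)
  let V₀ : D.state.PreGNS →ₗ[ℂ] H :=
    { toFun := fun a => emb (D.state.ofPreGNS a) ξ
      map_add' := fun a b => rfl
      map_smul' := fun c a => rfl }
  -- The squared GNS seminorm of a is ⟨ξ, a⋆aξ⟩ = ‖aξ‖², so a ↦ aξ is isometric.
  have hV₀ : ∀ a, ‖V₀ a‖ = ‖a‖ := fun a => by
    rw [PositiveLinearMap.preGNS_norm_def]
    change _ = √(inner ℂ ξ (ContinuousLinearMap.adjoint (emb (D.state.ofPreGNS a))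
      (emb (D.state.ofPreGNS a) ξ))).re
    rw [ContinuousLinearMap.adjoint_inner_right, norm_eq_sqrt_re_inner (𝕜 := ℂ)]
    rfl
  let V₁ : D.state.PreGNS →ₗᵢ[ℂ] H := ⟨V₀, hV₀⟩
  let V₂ : D.Hilbert →L[ℂ] H := V₁.toContinuousLinearMap.extend
    (UniformSpace.Completion.toComplL : D.state.PreGNS →L[ℂ] D.state.GNS)
  have hV₂ : ∀ a : D.state.PreGNS, V₂ a = V₀ a := fun a =>
    ContinuousLinearMap.extend_eq _ UniformSpace.Completion.denseRange_coe
      (UniformSpace.Completion.isUniformInducing_coe _) a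
  have hV₂n : ∀ η, ‖V₂ η‖ = ‖η‖ := fun η => by
    induction η using UniformSpace.Completion.induction_on with
    | hp => exact isClosed_eq (by fun_prop) (by fun_prop)
    | ih a => rw [hV₂, hV₀, UniformSpace.Completion.norm_coe]
  let V₃ : D.Hilbert →ₗᵢ[ℂ] H := ⟨V₂.toLinearMap, hV₂n⟩
  -- The range of an isometry of a complete space is closed, and it contains the dense orbit of ξ.
  have hsurj : Function.Surjective V₃ := by
    have hcl : IsClosed (Set.range V₃) := V₃.isometry.isClosedEmbedding.isClosed_range
    have hd : DenseRange V₃ := hc.mono (by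
      rintro _ ⟨a, rfl⟩
      exact ⟨(D.state.toPreGNS a : D.state.PreGNS), hV₂ _⟩)
    rw [← Set.range_eq_univ, ← hcl.closure_eq]
    exact hd.closure_range
  let V : D.Hilbert ≃ₗᵢ[ℂ] H := LinearIsometryEquiv.ofSurjective V₃ hsurj
  -- V intertwines the GNS representation with the identity representation; this is checked on the
  -- classes of algebra elements, on which a acts by left multiplication.
  have hVa : ∀ (a : D.A) (η : D.Hilbert),
      V (D.state.gnsStarAlgHom a η) = emb a (V η) := fun a η => by
    induction η using UniformSpace.Completion.induction_on with
    | hp => exact isClosed_eq (by fun_prop) ((emb a).continuous.comp V.continuous)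
    | ih b =>
      have h3 : D.state.gnsStarAlgHom a (b : D.state.GNS) =
          ((D.state.toPreGNS (a * D.state.ofPreGNS b) : D.state.PreGNS) : D.state.GNS) := by
        simp
      rw [h3]
      exact (hV₂ _).trans (congrArg (emb a) (hV₂ b).symm)
  have hconj : ∀ a : D.A, V.conjStarAlgEquiv (D.state.gnsStarAlgHom a) = emb a :=
    fun a => by
      ext η
      rw [LinearIsometryEquiv.conjStarAlgEquiv_apply_apply, hVa,
        LinearIsometryEquiv.apply_symm_apply]
  refine ⟨doubleCommutantCongr V fun x => ⟨?_, fun hx => ?_⟩⟩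
  · rintro ⟨a, rfl⟩
    exact (hconj a).symm ▸ Subtype.prop (p := (· ∈ A)) a
  · exact ⟨⟨_, hx⟩, V.conjStarAlgEquiv.injective (hconj ⟨_, hx⟩)⟩

end OperatorAlgebras

/-! ### Cyclicity of the vacuum and irreducibility of R_q -/

namespace QFock

variable {q : ℝ} {hq : |q| < 1}

theorem inner_vacuum_self : inner ℂ (vacuum q hq) (vacuum q hq) = (1 : ℂ) := by
  rw [inner_self_eq_norm_sq_to_K, norm_vacuum]; simp

theorem inner_tensor (w v : Word) :
    inner ℂ (tensor q hq w) (tensor q hq v) = wordForm q w v := by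
  rw [tensor, tensor, LinearIsometry.inner_map_map, inner_preTensor]

theorem tensor_zero (f : Fin 0 → OneParticle) : tensor q hq ⟨0, f⟩ = vacuum q hq := by
  rw [vacuum, Subsingleton.elim f Fin.elim0]

theorem inner_tensor_succ_vacuum {n : ℕ} (f : Fin (n + 1) → OneParticle) :
    inner ℂ (tensor q hq ⟨n + 1, f⟩) (vacuum q hq) = (0 : ℂ) := by
  rw [vacuum, inner_tensor, wordForm]
  simp

/-- A vector that is orthogonal to all tensors of positive degree is a multiple of the vacuum. -/
theorem eq_smul_vacuum {ξ : QFock q hq}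
    (h : ∀ (n : ℕ) (f : Fin (n + 1) → OneParticle), inner ℂ (tensor q hq ⟨n + 1, f⟩) ξ = (0 : ℂ)) :
    ξ = (inner ℂ (vacuum q hq) ξ : ℂ) • vacuum q hq := by
  rw [← sub_eq_zero]
  set ζ := ξ - (inner ℂ (vacuum q hq) ξ : ℂ) • vacuum q hq with hζ
  -- All tensors lie in the closed subspace orthogonal to ζ, hence so does ζ itself.
  have h1 : ζ ∈ (ℂ ∙ ζ)ᗮ := by
    refine tensor_induction (Submodule.isClosed_orthogonal _) (fun w => ?_) ζ
    rw [Submodule.mem_orthogonal_singleton_iff_inner_left, hζ, inner_sub_right, inner_smul_right]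
    obtain ⟨n, f⟩ := w
    cases n with
    | zero => rw [tensor_zero, inner_vacuum_self, mul_one, sub_self]
    | succ n => rw [h, inner_tensor_succ_vacuum, mul_zero, sub_zero]
  rw [Submodule.mem_orthogonal_singleton_iff_inner_left] at h1
  exact inner_self_eq_zero.1 h1

theorem creation_vacuum_single (i : ℤ) :
    creation q hq (e i) (vacuum q hq) = tensor q hq ⟨1, fun _ => e i⟩ := by
  rw [vacuum, creation_tensor]
  congr 2
  funext k
  obtain rfl : k = (0 : Fin 1) := Subsingleton.elim (α := Fin 1) _ _
  rfl

/-- This infinite orthonormal family serves twice: for the matrix units on the Fock space and for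
the infinite dimension of G_q''. -/
theorem orthonormal_tensor_e :
    Orthonormal ℂ fun i : ℤ => tensor q hq ⟨1, fun _ => e i⟩ := by
  rw [orthonormal_iff_ite]
  intro i j
  rw [inner_tensor, wordForm_same, ← inner_e, levelForm, Fintype.sum_eq_single 1]
  · have h : inversions (1 : Equiv.Perm (Fin 1)) = 0 := rfl
    simp [h]
  · exact fun π hπ => absurd (Subsingleton.elim π 1) hπ

/-- The vacuum is cyclic for every unital ⋆-algebra that contains the operators `a_i + a_i⁺`. -/
theorem denseRange_vacuum {A : StarSubalgebra ℂ (QFock q hq →L[ℂ] QFock q hq)}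
    (hA : ∀ i, field q hq i ∈ A) :
    DenseRange fun a : A => (a : QFock q hq →L[ℂ] QFock q hq) (vacuum q hq) := by
  let T : (QFock q hq →L[ℂ] QFock q hq) →ₗ[ℂ] QFock q hq :=
    (ContinuousLinearMap.apply ℂ (QFock q hq) (vacuum q hq)).toLinearMap
  let K₀ : Submodule ℂ (QFock q hq) := (Subalgebra.toSubmodule A.toSubalgebra).map T
  set K := K₀.topologicalClosure with hK
  have hKc : IsClosed (K : Set (QFock q hq)) := K₀.isClosed_topologicalClosure
  have hfield : ∀ i, ∀ ξ ∈ K, field q hq i ξ ∈ K := by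
    intro i ξ hξ
    refine map_mem_closure (field q hq i).continuous hξ ?_
    rintro _ ⟨a, ha, rfl⟩
    exact ⟨field q hq i * a, A.mul_mem (hA i) ha, rfl⟩
  -- Strong induction on the degree: e_i ⊗ t equals (a_i + a_i⁺)t - a_i t, where t has degree one
  -- less and a_i t, if not zero, has degree two less.
  have key : ∀ n : ℕ, ∀ m < n, ∀ f : Fin m → OneParticle, tensor q hq ⟨m, f⟩ ∈ K := by
    intro n
    induction n with
    | zero => exact fun m hm => absurd hm (Nat.not_lt_zero m)
    | succ n ih =>
      intro m hm f
      cases m with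
      | zero =>
        rw [tensor_zero]
        exact K₀.le_topologicalClosure ⟨1, one_mem A, rfl⟩
      | succ m =>
        have hm' : m < n := Nat.lt_of_succ_lt_succ hm
        rw [← Fin.cons_self_tail f]
        have h1 : ∀ i, creation q hq (e i) (tensor q hq ⟨m, Fin.tail f⟩) ∈ K := by
          intro i
          have h2 : creation q hq (e i) (tensor q hq ⟨m, Fin.tail f⟩) =
              field q hq i (tensor q hq ⟨m, Fin.tail f⟩) -
                ContinuousLinearMap.adjoint (creation q hq (e i))
                  (tensor q hq ⟨m, Fin.tail f⟩) := by
            rw [field, add_apply, annihilator, creator, add_sub_cancel_left]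
          rw [h2]
          refine sub_mem (hfield i _ (ih m hm' _)) ?_
          rw [adjoint_creation_tensor]
          cases m with
          | zero => simp [annWord]
          | succ m =>
            simp only [annWord, map_sum, map_smul]
            exact sum_mem fun k _ => K.smul_mem _ (ih m (by omega) _)
        have h3 := creation_apply_mem hKc h1 (f 0)
        rwa [creation_tensor] at h3
  intro ξ
  have h := tensor_induction hKc (fun w => key (w.1 + 1) w.1 (Nat.lt_succ_self _) w.2) ξ
  refine closure_mono ?_ h
  rintro _ ⟨a, ha, rfl⟩
  exact ⟨⟨a, ha⟩, rfl⟩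

theorem field_mem_algebraR (i : ℤ) : field q hq i ∈ algebraR q hq := by
  have h : annihilator q hq i ∈ algebraR q hq := subset_generatedCStarAlgebra ⟨i, rfl⟩
  have h2 : star (annihilator q hq i) = creator q hq i := by
    rw [annihilator, ← ContinuousLinearMap.star_eq_adjoint, star_star]
  exact add_mem h (h2 ▸ star_mem h)

theorem field_mem_algebraG (i : ℤ) : field q hq i ∈ algebraG q hq :=
  subset_generatedCStarAlgebra ⟨i, rfl⟩

/-- `R_q` acts irreducibly. -/
theorem doubleCommutant_algebraR :
    (doubleCommutant (algebraR q hq) : Set (QFock q hq →L[ℂ] QFock q hq)) = Set.univ := by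
  refine Set.eq_univ_of_forall fun x => mem_doubleCommutant_iff.2 fun y hy => ?_
  have h0 : ∀ i, ContinuousLinearMap.adjoint (creation q hq (e i)) (y (vacuum q hq)) = 0 := by
    intro i
    have h := hy (annihilator q hq i) (subset_generatedCStarAlgebra ⟨i, rfl⟩)
    refine (DFunLike.congr_fun h (vacuum q hq)).trans ?_
    change y (ContinuousLinearMap.adjoint (creation q hq (e i)) (vacuum q hq)) = 0
    rw [adjoint_creation_vacuum, map_zero]
  -- A vector annihilated by every a_i is orthogonal to every e_i ⊗ t, hence to every x ⊗ t.
  have h1 := eq_smul_vacuum (ξ := y (vacuum q hq)) fun n f => by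
    rw [← Submodule.mem_orthogonal_singleton_iff_inner_left, ← Fin.cons_self_tail f]
    have h2 := creation_apply_mem (K := (ℂ ∙ y (vacuum q hq))ᗮ)
      (η := tensor q hq ⟨n, Fin.tail f⟩) (Submodule.isClosed_orthogonal _) (fun i => by
        rw [Submodule.mem_orthogonal_singleton_iff_inner_left,
          ← ContinuousLinearMap.adjoint_inner_right, h0, inner_zero_right]) (f 0)
    rwa [creation_tensor] at h2
  set c : ℂ := inner ℂ (vacuum q hq) (y (vacuum q hq))
  -- On the dense orbit, y(aΩ) = a(yΩ) = c aΩ.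
  have h3 : y = c • 1 := by
    refine ContinuousLinearMap.ext fun ξ => ?_
    refine (denseRange_vacuum (q := q) (hq := hq) field_mem_algebraR).induction_on ξ
      (isClosed_eq y.continuous (c • (1 : QFock q hq →L[ℂ] QFock q hq)).continuous) fun a => ?_
    have h4 := DFunLike.congr_fun (hy a.1 a.2) (vacuum q hq)
    simp only [mul_apply_eq_comp] at h4
    rw [← h4, h1, map_smul]
    rfl
  rw [h3, smul_mul_assoc, mul_smul_comm, one_mul, mul_one]

/-! ### The trace on the double commutant of `G_q` -/

/-- The right fields lie in the commutant of G_q. The trace and factor properties need only these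
elements of the commutant, not a description of all of it. -/
theorem commute_rightField {x : QFock q hq →L[ℂ] QFock q hq}
    (hx : x ∈ doubleCommutant (algebraG q hq)) (i : ℤ) (ξ : QFock q hq) :
    rightField q hq i (x ξ) = x (rightField q hq i ξ) := by
  have h : rightField q hq i ∈
      Set.centralizer (algebraG q hq : Set (QFock q hq →L[ℂ] QFock q hq)) := by
    refine mem_centralizer_generatedCStarAlgebra ?_ ?_
    · rintro _ ⟨j, rfl⟩
      exact field_rightField j i
    · rintro _ ⟨j, rfl⟩
      rw [star_rightField]
      exact field_rightField j i
  exact DFunLike.congr_fun (mem_doubleCommutant_iff.1 hx _ h) ξ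

theorem inner_field (i : ℤ) (ξ η : QFock q hq) :
    inner ℂ (field q hq i ξ) η = (inner ℂ ξ (field q hq i η) : ℂ) := by
  rw [← ContinuousLinearMap.adjoint_inner_right, ← ContinuousLinearMap.star_eq_adjoint, star_field]

theorem inner_rightField (i : ℤ) (ξ η : QFock q hq) :
    inner ℂ (rightField q hq i ξ) η = (inner ℂ ξ (rightField q hq i η) : ℂ) := by
  rw [← ContinuousLinearMap.adjoint_inner_right, ← ContinuousLinearMap.star_eq_adjoint,
    star_rightField]

theorem inner_star_apply (x : QFock q hq →L[ℂ] QFock q hq) (ξ η : QFock q hq) :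
    inner ℂ (star x ξ) η = (inner ℂ ξ (x η) : ℂ) := by
  rw [ContinuousLinearMap.star_eq_adjoint, ContinuousLinearMap.adjoint_inner_left]

theorem inner_apply_star (x : QFock q hq →L[ℂ] QFock q hq) (ξ η : QFock q hq) :
    inner ℂ ξ (star x η) = (inner ℂ (x ξ) η : ℂ) := by
  rw [ContinuousLinearMap.star_eq_adjoint, ContinuousLinearMap.adjoint_inner_right]

/-- A generator is moved to the left-hand Ω, replaced there by its mirror image, carried back
through y, and replaced again at the right-hand Ω. The quantifier over y stays inside the induction,
since products and adjoints need the claim for other y. -/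
theorem vacuum_trace_adjoin {a : QFock q hq →L[ℂ] QFock q hq}
    (ha : a ∈ StarAlgebra.adjoin ℂ (generatorsG q hq)) :
    ∀ y ∈ doubleCommutant (algebraG q hq),
      (inner ℂ (vacuum q hq) (a (y (vacuum q hq))) : ℂ) =
        inner ℂ (vacuum q hq) (y (a (vacuum q hq))) := by
  have hsub : StarAlgebra.adjoin ℂ (generatorsG q hq) ≤
      (doubleCommutant (algebraG q hq)).toStarSubalgebra := fun x hx =>
    subset_doubleCommutant (StarSubalgebra.le_topologicalClosure _ hx)
  induction ha using StarAlgebra.adjoin_induction with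
  | mem a ha =>
    obtain ⟨i, rfl⟩ := ha
    intro y hy
    change (inner ℂ _ (field q hq i _) : ℂ) = inner ℂ _ (y (field q hq i _))
    rw [← inner_field, ← rightField_vacuum, inner_rightField, commute_rightField hy]
  | algebraMap c =>
    intro y _
    simp [Algebra.algebraMap_eq_smul_one]
  | add a b _ _ ha hb =>
    intro y hy
    simp only [add_apply, map_add, inner_add_right, ha y hy, hb y hy]
  | mul a b ha' hb' ha hb =>
    intro y hy
    -- Cyclic rotation in two moves: a(by) becomes (by)a = b(ya), which becomes (ya)b.
    have h1 := ha (b * y) (mul_mem (hsub hb') hy)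
    have h2 := hb (y * a) (mul_mem hy (hsub ha'))
    simp only [mul_apply_eq_comp] at h1 h2 ⊢
    rw [h1, h2]
  | star a ha' ha =>
    intro y hy
    have h1 := congrArg (starRingEnd ℂ) (ha (star y) (star_mem hy))
    rw [inner_conj_symm, inner_conj_symm] at h1
    rw [inner_apply_star, ← inner_star_apply y _ (star a _), inner_apply_star a, h1, inner_star_apply]

/-- For a in the algebra generated by the fields, the partial trace identity gives ‖a⋆Ω‖ = ‖aΩ‖ and
⟨y⋆Ω, aΩ⟩ = ⟨a⋆Ω, yΩ⟩. So pairing with y⋆Ω is bounded by ‖yΩ‖ on a dense set. This control of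
adjoints on Ω takes the place of Kaplansky density in `vacuum_trace`. -/
theorem norm_star_apply_vacuum_le {y : QFock q hq →L[ℂ] QFock q hq}
    (hy : y ∈ doubleCommutant (algebraG q hq)) :
    ‖star y (vacuum q hq)‖ ≤ ‖y (vacuum q hq)‖ := by
  have hsub : ∀ a ∈ StarAlgebra.adjoin ℂ (generatorsG q hq),
      a ∈ doubleCommutant (algebraG q hq) := fun x hx =>
    subset_doubleCommutant (StarSubalgebra.le_topologicalClosure _ hx)
  have hd := denseRange_vacuum (q := q) (hq := hq)
    (A := StarAlgebra.adjoin ℂ (generatorsG q hq)) fun i => StarAlgebra.subset_adjoin _ _ ⟨i, rfl⟩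
  have h1 : ∀ a ∈ StarAlgebra.adjoin ℂ (generatorsG q hq), ∀ z ∈ doubleCommutant (algebraG q hq),
      (inner ℂ (star z (vacuum q hq)) (a (vacuum q hq)) : ℂ) =
        inner ℂ (star a (vacuum q hq)) (z (vacuum q hq)) := fun a ha z hz => by
    rw [inner_star_apply, inner_star_apply, vacuum_trace_adjoin ha z hz]
  have h2 : ∀ a ∈ StarAlgebra.adjoin ℂ (generatorsG q hq),
      ‖star a (vacuum q hq)‖ = ‖a (vacuum q hq)‖ := fun a ha => by
    have h3 := h1 a ha (star a) (star_mem (hsub a ha))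
    rw [star_star, inner_self_eq_norm_sq_to_K, inner_self_eq_norm_sq_to_K] at h3
    have h4 : ‖a (vacuum q hq)‖ ^ 2 = ‖star a (vacuum q hq)‖ ^ 2 := by exact_mod_cast h3
    exact ((sq_eq_sq₀ (norm_nonneg _) (norm_nonneg _)).1 h4).symm
  have h3 : ∀ ξ, ‖(inner ℂ (star y (vacuum q hq)) ξ : ℂ)‖ ≤ ‖y (vacuum q hq)‖ * ‖ξ‖ := fun ξ => by
    refine hd.induction_on ξ (isClosed_le (by fun_prop) (by fun_prop)) fun a => ?_
    rw [h1 a a.2 y hy, ← h2 a a.2, mul_comm]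
    exact norm_inner_le_norm _ _
  have h4 := h3 (star y (vacuum q hq))
  rw [inner_self_eq_norm_sq_to_K, norm_pow, RCLike.norm_ofReal, abs_norm, sq] at h4
  rcases (norm_nonneg (star y (vacuum q hq))).eq_or_lt with h5 | h5
  · rw [← h5]; positivity
  · exact le_of_mul_le_mul_right h4 h5

theorem norm_star_apply_vacuum {y : QFock q hq →L[ℂ] QFock q hq}
    (hy : y ∈ doubleCommutant (algebraG q hq)) :
    ‖star y (vacuum q hq)‖ = ‖y (vacuum q hq)‖ := by
  refine (norm_star_apply_vacuum_le hy).antisymm ?_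
  simpa using norm_star_apply_vacuum_le (star_mem hy)

/-- The vacuum state is a trace on the double commutant of `G_q`. -/
theorem vacuum_trace {x y : QFock q hq →L[ℂ] QFock q hq}
    (hx : x ∈ doubleCommutant (algebraG q hq)) (hy : y ∈ doubleCommutant (algebraG q hq)) :
    (inner ℂ (vacuum q hq) (x (y (vacuum q hq))) : ℂ) =
      inner ℂ (vacuum q hq) (y (x (vacuum q hq))) := by
  have hd := denseRange_vacuum (q := q) (hq := hq)
    (A := StarAlgebra.adjoin ℂ (generatorsG q hq)) fun i => StarAlgebra.subset_adjoin _ _ ⟨i, rfl⟩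
  have key : ∀ ε > 0, ‖(inner ℂ (vacuum q hq) (x (y (vacuum q hq))) : ℂ) -
      inner ℂ (vacuum q hq) (y (x (vacuum q hq)))‖ ≤ ε * (2 * ‖x (vacuum q hq)‖) := by
    intro ε hε
    -- If (y - a)Ω is small, then so is (y - a)⋆Ω by `norm_star_apply_vacuum`. The contributions of
    -- a cancel by `vacuum_trace_adjoin`, which leaves two small inner products.
    obtain ⟨a, ha⟩ := hd.exists_dist_lt (y (vacuum q hq)) hε
    have haM : (a : QFock q hq →L[ℂ] QFock q hq) ∈ doubleCommutant (algebraG q hq) :=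
      subset_doubleCommutant (StarSubalgebra.le_topologicalClosure _ a.2)
    rw [dist_eq_norm, ← sub_apply] at ha
    have h1 : (inner ℂ (vacuum q hq) (x (y (vacuum q hq))) : ℂ) -
        inner ℂ (vacuum q hq) (y (x (vacuum q hq))) =
        inner ℂ (star x (vacuum q hq)) ((y - a) (vacuum q hq)) -
          inner ℂ (star (y - a) (vacuum q hq)) (x (vacuum q hq)) := by
      have h2 := vacuum_trace_adjoin a.2 x hx
      rw [inner_star_apply, inner_star_apply]
      simp only [sub_apply, map_sub, inner_sub_right, h2]
      ring
    rw [h1]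
    have h3 := norm_inner_le_norm (𝕜 := ℂ) (star x (vacuum q hq)) ((y - a) (vacuum q hq))
    have h4 := norm_inner_le_norm (𝕜 := ℂ) (star (y - a) (vacuum q hq)) (x (vacuum q hq))
    rw [norm_star_apply_vacuum hx] at h3
    rw [norm_star_apply_vacuum (sub_mem hy haM)] at h4
    refine (norm_sub_le _ _).trans ?_
    nlinarith [norm_nonneg (x (vacuum q hq))]
  rw [← sub_eq_zero, ← norm_le_zero_iff]
  refine le_of_forall_pos_le_add fun ε hε => ?_
  refine (key (ε / (2 * ‖x (vacuum q hq)‖ + 1)) (by positivity)).trans ?_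
  rw [zero_add, div_mul_eq_mul_div, div_le_iff₀ (by positivity)]
  nlinarith

/-- The vacuum is separating: ‖xaΩ‖ = ‖a⋆x⋆Ω‖ for a in G_q, and x⋆Ω has the norm of xΩ, which is
zero. Cyclicity then finishes. -/
theorem eq_zero_of_apply_vacuum {x : QFock q hq →L[ℂ] QFock q hq}
    (hx : x ∈ doubleCommutant (algebraG q hq)) (h : x (vacuum q hq) = 0) : x = 0 := by
  refine ContinuousLinearMap.ext fun ξ => ?_
  refine (denseRange_vacuum (q := q) (hq := hq) field_mem_algebraG).induction_on ξ
    (isClosed_eq (by fun_prop) (by fun_prop)) fun a => ?_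
  have h1 := norm_star_apply_vacuum (mul_mem hx (subset_doubleCommutant a.2))
  have h2 : star x (vacuum q hq) = 0 := by
    rw [← norm_eq_zero, norm_star_apply_vacuum hx, h, norm_zero]
  rw [star_mul, mul_apply_eq_comp, mul_apply_eq_comp, h2, map_zero, norm_zero] at h1
  rw [norm_eq_zero.1 h1.symm, zero_apply]

theorem vacuum_isFaithfulNormalTracialState :
    IsFaithfulNormalTracialState (doubleCommutant (algebraG q hq))
      (vectorFunctional (doubleCommutant (algebraG q hq)).toStarSubalgebra (vacuum q hq)) where
  map_one := inner_vacuum_self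
  nonneg x := by
    change 0 ≤ inner ℂ _ (star (x : QFock q hq →L[ℂ] QFock q hq) (x.1 (vacuum q hq)))
    rw [inner_apply_star, inner_self_eq_norm_sq_to_K]
    simp
  faithful x hx := by
    change inner ℂ _ (star (x : QFock q hq →L[ℂ] QFock q hq) (x.1 (vacuum q hq))) = (0 : ℂ) at hx
    rw [inner_apply_star, inner_self_eq_zero] at hx
    exact Subtype.ext (eq_zero_of_apply_vacuum x.2 hx)
  tracial x y := vacuum_trace x.2 y.2
  normal := by
    -- A vector state is ultraweakly continuous through a series with a single nonzero term.
    refine ⟨Pi.single 0 (vacuum q hq), Pi.single 0 (vacuum q hq), ?_, ?_, fun x => ?_⟩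
    · exact summable_of_ne_finset_zero (s := {0}) fun n hn => by
        simp [Pi.single_eq_of_ne (Finset.notMem_singleton.1 hn)]
    · exact summable_of_ne_finset_zero (s := {0}) fun n hn => by
        simp [Pi.single_eq_of_ne (Finset.notMem_singleton.1 hn)]
    · have h := hasSum_single (f := fun n => (inner ℂ
        ((Pi.single 0 (vacuum q hq) : ℕ → QFock q hq) n) ((x : QFock q hq →L[ℂ] QFock q hq)
          ((Pi.single 0 (vacuum q hq) : ℕ → QFock q hq) n)) : ℂ)) 0 fun n hn => by
          simp [Pi.single_eq_of_ne hn]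
      rw [Pi.single_eq_same] at h
      exact h

/-! ### Factoriality -/

theorem tendsto_adjoint_rightCreation_e (ξ : QFock q hq) :
    Filter.Tendsto (fun i => ContinuousLinearMap.adjoint (rightCreation q hq (e i)) ξ)
      Filter.cofinite (nhds 0) := by
  simp only [adjoint_rightCreation_apply]
  have h := ((reversal q hq).continuous.tendsto 0).comp
    (tendsto_adjoint_creation_e (reversal q hq ξ))
  rwa [map_zero] at h

/-- Both fields are tested against e_i ⊗ t as i tends to infinity. The left annihilator removes e_i
from the front with weight 1, the right one removes it after passing the n + 1 factors of t, with
weight q^(n+1); all other terms vanish in the limit because annihilators tend strongly to zero. -/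
theorem inner_tensor_eq_zero_of_field_eq {ξ : QFock q hq}
    (h : ∀ i, field q hq i ξ = rightField q hq i ξ) (n : ℕ) (f : Fin (n + 1) → OneParticle) :
    inner ℂ (tensor q hq ⟨n + 1, f⟩) ξ = (0 : ℂ) := by
  set t := tensor q hq ⟨n + 1, f⟩ with ht
  let l : ℤ → QFock q hq →L[ℂ] QFock q hq := fun i => creation q hq (e i)
  let l' : ℤ → QFock q hq →L[ℂ] QFock q hq := fun i => ContinuousLinearMap.adjoint (l i)
  let r : ℤ → QFock q hq →L[ℂ] QFock q hq := fun i => rightCreation q hq (e i)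
  let r' : ℤ → QFock q hq →L[ℂ] QFock q hq := fun i => ContinuousLinearMap.adjoint (r i)
  have hl : ∀ i, ‖l i‖ ≤ (Real.sqrt (1 - |q|))⁻¹ := fun i => by
    simpa [norm_e] using norm_creation_le (q := q) (hq := hq) (e i)
  have hb : ∀ {ζ : ℤ → QFock q hq}, Filter.Tendsto ζ Filter.cofinite (nhds 0) →
      Filter.Tendsto (fun i => l i (ζ i)) Filter.cofinite (nhds 0) := by
    intro ζ hζ
    refine squeeze_zero_norm (fun i => ContinuousLinearMap.le_of_opNorm_le _ (hl i) _) ?_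
    simpa using hζ.norm.const_mul (Real.sqrt (1 - |q|))⁻¹
  have hbi : ∀ {ζ : ℤ → QFock q hq}, Filter.Tendsto ζ Filter.cofinite (nhds 0) →
      Filter.Tendsto (fun i => (inner ℂ (l i t) (ζ i) : ℂ)) Filter.cofinite (nhds 0) := by
    intro ζ hζ
    refine squeeze_zero_norm (a := fun i => ((Real.sqrt (1 - |q|))⁻¹ * ‖t‖) * ‖ζ i‖)
      (fun i => ?_) (by simpa using hζ.norm.const_mul ((Real.sqrt (1 - |q|))⁻¹ * ‖t‖))
    refine (norm_inner_le_norm _ _).trans ?_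
    gcongr
    exact ContinuousLinearMap.le_of_opNorm_le _ (hl i) _
  have h1 : Filter.Tendsto (fun i => (inner ℂ (l i t) (field q hq i ξ) : ℂ)) Filter.cofinite
      (nhds (inner ℂ t ξ)) := by
    have e1 : ∀ i, (inner ℂ (l i t) (field q hq i ξ) : ℂ) =
        inner ℂ (l i t) (l' i ξ) + inner ℂ (t + (q : ℂ) • l i (l' i t)) ξ := fun i => by
      have e2 : l' i (l i t) = t + (q : ℂ) • l i (l' i t) := by
        have := commutation (q := q) (hq := hq) (e i) (e i) t
        rwa [inner_e, if_pos rfl, one_smul] at this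
      rw [← e2, ContinuousLinearMap.adjoint_inner_left, ← inner_add_right]
      rfl
    simp only [e1]
    have e3 := (hb (tendsto_adjoint_creation_e t)).const_smul (q : ℂ)
    have e4 := (e3.const_add t).inner (𝕜 := ℂ) (tendsto_const_nhds (x := ξ))
    have e5 := (hbi (tendsto_adjoint_creation_e ξ)).add e4
    rw [smul_zero, add_zero, zero_add] at e5
    exact e5
  have h2 : Filter.Tendsto (fun i => (inner ℂ (l i t) (rightField q hq i ξ) : ℂ)) Filter.cofinite
      (nhds ((q : ℂ) ^ (n + 1) * inner ℂ t ξ)) := by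
    have e1 : ∀ i, (inner ℂ (l i t) (rightField q hq i ξ) : ℂ) =
        inner ℂ (l i t) (r' i ξ) + inner ℂ (l i (r' i t) + ((q : ℂ) ^ (n + 1)) • t) ξ := fun i => by
      have e2 : r' i (l i t) = l i (r' i t) + ((q : ℂ) ^ (n + 1)) • t := by
        have := adjoint_rightCreation_creation (q := q) (hq := hq) (e i) (e i) f
        rwa [inner_e, if_pos rfl, mul_one] at this
      rw [← e2, ContinuousLinearMap.adjoint_inner_left, ← inner_add_right]
      rfl
    simp only [e1]
    have e3 := hb (tendsto_adjoint_rightCreation_e t)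
    have e4 := (e3.add_const (((q : ℂ) ^ (n + 1)) • t)).inner (𝕜 := ℂ)
      (tendsto_const_nhds (x := ξ))
    have e5 := (hbi (tendsto_adjoint_rightCreation_e ξ)).add e4
    rw [zero_add, zero_add, inner_smul_left, map_pow, Complex.conj_ofReal] at e5
    exact e5
  simp only [h] at h1
  have h3 := tendsto_nhds_unique h1 h2
  -- Positive degree matters here: for the vacuum the exponent would be 0 and the two limits would
  -- agree.
  have h4 : (1 - (q : ℂ) ^ (n + 1)) ≠ 0 := by
    intro h5
    have h6 : (q : ℂ) ^ (n + 1) = 1 := (sub_eq_zero.1 h5).symm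
    have h7 := congrArg norm h6
    rw [norm_pow, Complex.norm_real, Real.norm_eq_abs, norm_one] at h7
    exact (pow_lt_one₀ (abs_nonneg q) hq (Nat.succ_ne_zero n)).ne h7
  refine (mul_eq_zero.1 (?_ : (1 - (q : ℂ) ^ (n + 1)) * inner ℂ t ξ = 0)).resolve_left h4
  rw [sub_mul, one_mul, ← h3, sub_self]

theorem field_vacuum (i : ℤ) :
    field q hq i (vacuum q hq) = tensor q hq ⟨1, fun _ => e i⟩ := by
  rw [field, add_apply, annihilator, creator, adjoint_creation_vacuum, zero_add,
    creation_vacuum_single]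

theorem isIIOneFactor_algebraG : IsIIOneFactor (doubleCommutant (algebraG q hq)) where
  center_trivial z hz hcomm := by
    -- Both sides equal z applied to the common value of the two fields at Ω: z commutes with the
    -- left field by centrality, and with the right field as an element of G_q''.
    have h1 : ∀ i, field q hq i (z (vacuum q hq)) = rightField q hq i (z (vacuum q hq)) := by
      intro i
      rw [commute_rightField hz, rightField_vacuum]
      exact (DFunLike.congr_fun (hcomm _ (subset_doubleCommutant (field_mem_algebraG i)))
        (vacuum q hq)).symm
    have h2 := eq_smul_vacuum (inner_tensor_eq_zero_of_field_eq h1)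
    set c : ℂ := inner ℂ (vacuum q hq) (z (vacuum q hq))
    refine ⟨c, sub_eq_zero.1 (eq_zero_of_apply_vacuum
      (sub_mem hz ((doubleCommutant (algebraG q hq)).toStarSubalgebra.smul_mem (one_mem _) c)) ?_)⟩
    rw [sub_apply, h2, smul_apply]
    exact sub_self _
  infinite_dimensional := by
    intro hfin
    let T : (doubleCommutant (algebraG q hq)).toStarSubalgebra →ₗ[ℂ] QFock q hq :=
      { toFun := fun x => (x : QFock q hq →L[ℂ] QFock q hq) (vacuum q hq)
        map_add' := fun _ _ => rfl
        map_smul' := fun _ _ => rfl }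
    let v : ℤ → (doubleCommutant (algebraG q hq)).toStarSubalgebra := fun i =>
      ⟨field q hq i, subset_doubleCommutant (field_mem_algebraG i)⟩
    -- Evaluation at Ω sends the fields to an orthonormal family.
    have hv : LinearIndependent ℂ v := LinearIndependent.of_comp T (by
      have : T ∘ v = fun i : ℤ => tensor q hq ⟨1, fun _ => e i⟩ := funext field_vacuum
      rw [this]
      exact orthonormal_tensor_e.linearIndependent)
    have := hv.finite
    exact not_finite ℤ
  exists_trace := ⟨_, vacuum_isFaithfulNormalTracialState⟩

/-! ### Non-isomorphism and the main theorem -/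

theorem isEmpty_starAlgEquiv_doubleCommutant (q : ℝ) (hq : |q| < 1) :
    IsEmpty ((doubleCommutant (algebraR q hq)).toStarSubalgebra ≃⋆ₐ[ℂ]
      (doubleCommutant (algebraG q hq)).toStarSubalgebra) :=
  isEmpty_starAlgEquiv_of_trace doubleCommutant_algebraR
    ((orthonormal_tensor_e (q := q) (hq := hq)).comp ((↑) : ℕ → ℤ) Nat.cast_injective)
    vacuum_isFaithfulNormalTracialState

theorem isEmpty_starAlgEquiv_vonNeumann (q : ℝ) (hq : |q| < 1) :
    IsEmpty ((systemR q hq).vonNeumann.toStarSubalgebra ≃⋆ₐ[ℂ]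
      (systemG q hq).vonNeumann.toStarSubalgebra) := by
  obtain ⟨βR⟩ := nonempty_vonNeumann_vectorSystem (generatorsR q hq)
    (secondQuantization q hq shift) (shift_generatorsR q hq) (shift_symm_generatorsR q hq)
    (vacuum q hq) (norm_vacuum q hq) (secondQuantization_vacuum q hq shift)
    (denseRange_vacuum field_mem_algebraR)
  obtain ⟨βG⟩ := nonempty_vonNeumann_vectorSystem (generatorsG q hq)
    (secondQuantization q hq shift) (shift_generatorsG q hq) (shift_symm_generatorsG q hq)
    (vacuum q hq) (norm_vacuum q hq) (secondQuantization_vacuum q hq shift)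
    (denseRange_vacuum field_mem_algebraG)
  exact ⟨fun β => (isEmpty_starAlgEquiv_doubleCommutant q hq).false
    ((βR.symm.trans β).trans βG)⟩

end QFock

end
theorem mainTheorem5 (q : ℝ) (hq : |q| < 1) :
    ¬ (QFock.systemR q hq).Conjugate (QFock.systemG q hq) ∧
    (doubleCommutant (QFock.algebraR q hq) : Set (QFock q hq →L[ℂ] QFock q hq)) = Set.univ ∧
    IsIIOneFactor (doubleCommutant (QFock.algebraG q hq)) ∧
    IsFaithfulNormalTracialState (doubleCommutant (QFock.algebraG q hq))
      (vectorFunctional (doubleCommutant (QFock.algebraG q hq)).toStarSubalgebra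
        (QFock.vacuum q hq)) ∧
    IsEmpty ((doubleCommutant (QFock.algebraR q hq)).toStarSubalgebra ≃⋆ₐ[ℂ]
      (doubleCommutant (QFock.algebraG q hq)).toStarSubalgebra) ∧
    IsEmpty ((QFock.systemR q hq).vonNeumann.toStarSubalgebra ≃⋆ₐ[ℂ]
      (QFock.systemG q hq).vonNeumann.toStarSubalgebra) :=
  -- The dynamics and the states are discarded: the underlying isomorphism of algebras is already
  -- impossible.
  ⟨fun ⟨β, _⟩ => (QFock.isEmpty_starAlgEquiv_vonNeumann q hq).false β,
    QFock.doubleCommutant_algebraR, QFock.isIIOneFactor_algebraG,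
    QFock.vacuum_isFaithfulNormalTracialState, QFock.isEmpty_starAlgEquiv_doubleCommutant q hq,
    QFock.isEmpty_starAlgEquiv_vonNeumann q hq⟩
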